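/- Theorem. Let $G$ be a countable simple graph (finite or countably infinite, not necessarily connected) in which every non-trivial automorphism moves infinitely many edges. A 2-edge colouring of $G$ is a map $c\colon E(G)\to\{0,1\}$. It is distinguishing if the identity is the only $\gamma\in\operatorname{Aut} G$ with $c\circ\gamma=c$. Two colourings $c,d$ are isomorphic if $c\circ\gamma=d$ for some $\gamma\in\operatorname{Aut} G$. (i) If $G$ has infinitely many vertices, then $G$ has $2^{\aleph_0}$ pairwise non-isomorphic distinguishing 2-edge colourings; that is, the set of isomorphism classes of distinguishing 2-edge colourings of $G$ has cardinality exactly $2^{\aleph_0}$. (ii) In all cases $D'(G)\le 2$, where the distinguishing index $D'(G)$ is the least number of colours in a distinguishing edge colouring of $G$. (In particular, the infinite edge motion conjecture of Broere and Pilśniak holds.) -/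

import Mathlib

open scoped Cardinal

namespace EdgeColouring

universe u v

variable {V : Type u}

/-- Every non-trivial automorphism of `G` moves infinitely many edges. -/
def HasInfiniteEdgeMotion (G : SimpleGraph V) : Prop :=
  ∀ γ : G ≃g G, γ ≠ SimpleGraph.Iso.refl → {e : G.edgeSet | γ.mapEdgeSet e ≠ e}.Infinite

/-- The automorphism `γ` preserves the edge colouring `c`, that is, `c ∘ γ = c`. -/
def Preserves {G : SimpleGraph V} {C : Type v} (γ : G ≃g G) (c : G.edgeSet → C) : Prop :=
  c ∘ γ.mapEdgeSet = c

/-- The identity is the only automorphism that preserves the edge colouring `c`. -/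
def IsDistinguishing {G : SimpleGraph V} {C : Type v} (c : G.edgeSet → C) : Prop :=
  ∀ γ : G ≃g G, Preserves γ c → γ = SimpleGraph.Iso.refl

/-- Edge colourings `c` and `d` are isomorphic if `c ∘ γ = d` for some automorphism `γ`. -/
def Isomorphic {G : SimpleGraph V} {C : Type v} (c d : G.edgeSet → C) : Prop :=
  ∃ γ : G ≃g G, c ∘ γ.mapEdgeSet = d

theorem isomorphic_equivalence (G : SimpleGraph V) (C : Type v) :
    Equivalence (Isomorphic (G := G) (C := C)) where
  refl c := by
    refine ⟨SimpleGraph.Iso.refl, funext fun e => congrArg c ?_⟩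
    apply Subtype.ext
    change Sym2.map id e.1 = e.1
    rw [Sym2.map_id, id]
  symm := by
    rintro c d ⟨γ, rfl⟩
    refine ⟨γ.symm, funext fun e => congrArg c ?_⟩
    exact γ.mapEdgeSet.apply_symm_apply e
  trans := by
    rintro c d f ⟨γ, rfl⟩ ⟨δ, rfl⟩
    refine ⟨δ.trans γ, funext fun e => congrArg c ?_⟩
    apply Subtype.ext
    change Sym2.map (γ ∘ δ) e.1 = Sym2.map γ (Sym2.map δ e.1)
    rw [Sym2.map_map]

/-- The distinguishing edge colourings of `G` with colours in `C`. -/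
abbrev DistinguishingColouring (G : SimpleGraph V) (C : Type v) : Type (max u v) :=
  {c : G.edgeSet → C // IsDistinguishing c}

/-- Isomorphism of distinguishing edge colourings. -/
def isoSetoid (G : SimpleGraph V) (C : Type v) : Setoid (DistinguishingColouring G C) where
  r c d := Isomorphic c.1 d.1
  iseqv := (isomorphic_equivalence G C).comap Subtype.val

/-- The distinguishing index `D'(G)`: the least number `k` of colours for which `G` has a
distinguishing edge colouring. It is `⊤` if no finite number of colours suffices. -/
noncomputable def distinguishingIndex (G : SimpleGraph V) : ℕ∞ :=
  ⨅ (k : ℕ) (_ : ∃ c : G.edgeSet → Fin k, IsDistinguishing c), (k : ℕ∞)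

end EdgeColouring

/-! ### Automorphisms of finite support -/

namespace EdgeColouring
variable {V : Type*} {G : SimpleGraph V}

/-! Infinite edge motion is used through one consequence: an automorphism whose support is a finite
set of vertices of finite degree moves finitely many edges, so it is trivial.

Suppose first that `G` is infinite and connected. Take a normal spanning tree `T`, rooted at a
vertex of infinite degree if there is one. Two isomorphic finite sibling branches with the same
attachments could be swapped, so a branch of bounded height is finite; hence every infinite branch
is unboundedly high (`exists_le_lev_gt`). This leaves room for a sparse sequence of flags: edges `p
n`–`s n` of `G` with `p n` below `s n`, whose tree segments are disjoint and which recur in every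
infinite branch. Colour 1 is given to the symmetric difference of `T` and the flags with index in
`A`.

The colouring determines the union of `T` and the active flags (`core_iff`), and in it the active
segments (`loops_iff`). So an automorphism carrying the colouring for `A` to the one for `B` carries
active segments to active segments. The levels of the `s n` grow so fast that segment `n` can only
go to itself once `n` is at least the distance by which the root moves (`mem_of_dist_le`). Hence `A`
and `B` agree from some index on, and coding each bit of a set `X` at infinitely many indices yields
continuum many non-isomorphic colourings.

An automorphism `γ` preserving one of these colourings fixes, outside a finite set `P` of vertices
of finite degree, each vertex that has an infinite branch and is not strictly inside an active
segment. A moved vertex outside `P` with an infinite branch is thus strictly inside a segment that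
`γ` reflects, and this reflection interchanges two finite sides (`interchange`). It follows that
each connected set of moved vertices is finite with finite degrees, and `movedAdj_class_not_finite`
gives `γ = 1` (`Controlled.eq_refl`).

For general `G`, finite components are fixed pointwise by all automorphisms. Infinite components are
coloured by the connected case, with the index of the component coded into the colouring so that
isomorphic components cannot be exchanged. If all components are finite, `G` is asymmetric, every
colouring is distinguishing, and it remains to see that there are infinitely many edges. -/

theorem HasInfiniteEdgeMotion.eq_refl_of_fixed_off (hG : HasInfiniteEdgeMotion G) (γ : G ≃g G)
    {S : Set V} (hS : S.Finite) (hdeg : ∀ v ∈ S, (G.neighborSet v).Finite)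
    (h : ∀ z ∉ S, γ z = z) : γ = SimpleGraph.Iso.refl := by
  by_contra hne
  refine hG γ hne ?_
  have hfin : (⋃ v ∈ S, (fun w => s(v, w)) '' G.neighborSet v).Finite :=
    hS.biUnion fun v hv => (hdeg v hv).image _
  refine Set.Finite.of_finite_image (f := Subtype.val) (hfin.subset ?_)
    Subtype.val_injective.injOn
  rintro _ ⟨⟨e, he⟩, hmoved, rfl⟩
  induction e with | _ x y =>
  rw [SimpleGraph.mem_edgeSet] at he
  simp only [Set.mem_iUnion]
  by_cases hx : x ∈ S
  · exact ⟨x, hx, y, he, rfl⟩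
  by_cases hy : y ∈ S
  · exact ⟨y, hy, x, he.symm, Sym2.eq_swap⟩
  refine absurd (Subtype.ext ?_) hmoved
  change Sym2.map γ s(x, y) = s(x, y)
  rw [Sym2.map_mk, h x hx, h y hy]

/-- The map that is `σ` on `A`, `τ` on `A'` and the identity elsewhere is an automorphism with
finite support, hence trivial. This is the form in which infinite edge motion is applied to sibling
branches, to classes of moved vertices and to finite components. -/
theorem HasInfiniteEdgeMotion.swap_eq_self (hG : HasInfiniteEdgeMotion G) {A A' : Set V}
    {σ τ : V → V} (hσ : Set.MapsTo σ A A') (hτ : Set.MapsTo τ A' A)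
    (hτσ : ∀ x ∈ A, τ (σ x) = x) (hστ : ∀ x ∈ A', σ (τ x) = x)
    (hAA : A = A' ∨ Disjoint A A')
    (hadj : ∀ x ∈ A, ∀ y ∈ A, G.Adj (σ x) (σ y) ↔ G.Adj x y)
    (hout : ∀ x ∈ A, ∀ z, z ∉ A → z ∉ A' → (G.Adj (σ x) z ↔ G.Adj x z))
    (hno : Disjoint A A' → ∀ x ∈ A, ∀ y ∈ A', ¬ G.Adj x y)
    (hA : A.Finite) (hdA : ∀ v ∈ A, (G.neighborSet v).Finite)
    (hdA' : ∀ v ∈ A', (G.neighborSet v).Finite) : ∀ x ∈ A, σ x = x := by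
  classical
  have hA' : A'.Finite := (hA.image σ).subset fun x hx => ⟨τ x, hτ hx, hστ x hx⟩
  have hdis : ∀ x, x ∈ A → ∀ y, y ∈ A' → y ∉ A → Disjoint A A' := by
    rintro x hx y hy hyA
    rcases hAA with h | h
    · exact absurd (h ▸ hy) hyA
    · exact h
  have hdis' : ∀ y, y ∈ A' → y ∉ A → Disjoint A A' := by
    rintro y hy hyA
    exact hdis (τ y) (hτ hy) y hy hyA
  have hdis'' : ∀ y, y ∈ A → y ∉ A' → Disjoint A A' := by
    rintro y hy hyA
    rcases hAA with h | h
    · exact absurd (h ▸ hy) hyA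
    · exact h
  have hadj' : ∀ x ∈ A', ∀ y ∈ A', G.Adj (τ x) (τ y) ↔ G.Adj x y := fun x hx y hy => by
    rw [← hadj _ (hτ hx) _ (hτ hy), hστ x hx, hστ y hy]
  have hout' : ∀ x ∈ A', ∀ z, z ∉ A → z ∉ A' → (G.Adj (τ x) z ↔ G.Adj x z) :=
    fun x hx z hz hz' => by
      rw [← hout _ (hτ hx) z hz hz', hστ x hx]
  let f : V → V := fun z => if z ∈ A then σ z else if z ∈ A' then τ z else z
  let g : V → V := fun z => if z ∈ A' then τ z else if z ∈ A then σ z else z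
  have hfg : ∀ z, f (g z) = z := by
    intro z
    by_cases h1 : z ∈ A'
    · simp only [f, g, if_pos h1, if_pos (hτ h1), hστ z h1]
    by_cases h2 : z ∈ A
    · have hd := Set.disjoint_right.1 (hdis'' z h2 h1) (hσ h2)
      simp only [f, g, if_neg h1, if_pos h2, if_neg hd, if_pos (hσ h2), hτσ z h2]
    · simp only [f, g, if_neg h1, if_neg h2]
  have hgf : ∀ z, g (f z) = z := by
    intro z
    by_cases h1 : z ∈ A
    · simp only [f, g, if_pos h1, if_pos (hσ h1), hτσ z h1]
    by_cases h2 : z ∈ A'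
    · have hd := Set.disjoint_left.1 (hdis' z h2 h1) (hτ h2)
      simp only [f, g, if_neg h1, if_pos h2, if_neg hd, if_pos (hτ h2), hστ z h2]
    · simp only [f, g, if_neg h1, if_neg h2]
  have hrel : ∀ x y, G.Adj (f x) (f y) ↔ G.Adj x y := by
    intro x y
    by_cases hx : x ∈ A
    · by_cases hy : y ∈ A
      · simp only [f, if_pos hx, if_pos hy, hadj x hx y hy]
      by_cases hy' : y ∈ A'
      · have hd := hdis' y hy' hy
        simp only [f, if_pos hx, if_neg hy, if_pos hy']
        exact iff_of_false (fun h => hno hd _ (hτ hy') _ (hσ hx) h.symm) (hno hd _ hx _ hy')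
      · simp only [f, if_pos hx, if_neg hy, if_neg hy', hout x hx y hy hy']
    by_cases hx' : x ∈ A'
    · by_cases hy : y ∈ A
      · have hd := hdis' x hx' hx
        simp only [f, if_neg hx, if_pos hx', if_pos hy]
        exact iff_of_false (fun h => hno hd _ (hτ hx') _ (hσ hy) h)
          (fun h => hno hd _ hy _ hx' h.symm)
      by_cases hy' : y ∈ A'
      · simp only [f, if_neg hx, if_pos hx', if_neg hy, if_pos hy', hadj' x hx' y hy']
      · simp only [f, if_neg hx, if_pos hx', if_neg hy, if_neg hy', hout' x hx' y hy hy']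
    · by_cases hy : y ∈ A
      · simp only [f, if_neg hx, if_neg hx', if_pos hy]
        rw [G.adj_comm, hout y hy x hx hx', G.adj_comm]
      by_cases hy' : y ∈ A'
      · simp only [f, if_neg hx, if_neg hx', if_neg hy, if_pos hy']
        rw [G.adj_comm, hout' y hy' x hx hx', G.adj_comm]
      · simp only [f, if_neg hx, if_neg hx', if_neg hy, if_neg hy']
  let γ : G ≃g G := ⟨⟨f, g, hgf, hfg⟩, fun {x y} => hrel x y⟩
  have hγ : γ = SimpleGraph.Iso.refl := by
    refine hG.eq_refl_of_fixed_off γ (hA.union hA') ?_ ?_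
    · rintro v (hv | hv)
      exacts [hdA v hv, hdA' v hv]
    · intro z hz
      simp only [Set.mem_union, not_or] at hz
      change f z = z
      simp only [f, if_neg hz.1, if_neg hz.2]
  intro x hx
  have : γ x = x := by rw [hγ]; rfl
  change f x = x at this
  simpa only [f, if_pos hx] using this

/-- Two vertices are linked by `γ` if they are adjacent and both moved. -/
def MovedAdj (γ : G ≃g G) (x y : V) : Prop := G.Adj x y ∧ γ x ≠ x ∧ γ y ≠ y

theorem MovedAdj.symm {γ : G ≃g G} {x y : V} (h : MovedAdj γ x y) : MovedAdj γ y x :=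
  ⟨h.1.symm, h.2.2, h.2.1⟩

theorem MovedAdj.map {γ : G ≃g G} {x y : V} (h : MovedAdj γ x y) : MovedAdj γ (γ x) (γ y) :=
  ⟨γ.map_adj_iff.2 h.1, fun h' => h.2.1 (γ.injective h'), fun h' => h.2.2 (γ.injective h')⟩

theorem MovedAdj.map_symm {γ : G ≃g G} {x y : V} (h : MovedAdj γ x y) :
    MovedAdj γ (γ.symm x) (γ.symm y) := by
  refine ⟨γ.symm.map_adj_iff.2 h.1, fun h' => h.2.1 ?_, fun h' => h.2.2 ?_⟩
  · rw [RelIso.apply_symm_apply] at h'; conv_lhs => rw [h', RelIso.apply_symm_apply]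
  · rw [RelIso.apply_symm_apply] at h'; conv_lhs => rw [h', RelIso.apply_symm_apply]

/-- Cut `γ` down to one class `D` of moved vertices: use `γ` on `D` and its inverse on the image of
`D`. A neighbour of `D` or of its image that lies outside both is fixed by `γ`, so adjacency is
preserved. -/
theorem HasInfiniteEdgeMotion.movedAdj_class_not_finite (hG : HasInfiniteEdgeMotion G)
    (γ : G ≃g G) {z : V} (hz : γ z ≠ z)
    (hfin : {w | Relation.ReflTransGen (MovedAdj γ) z w}.Finite)
    (hdeg : ∀ v, Relation.ReflTransGen (MovedAdj γ) z v → (G.neighborSet v).Finite) : False := by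
  set D : Set V := {w | Relation.ReflTransGen (MovedAdj γ) z w} with hD
  have hsymm : ∀ {x y}, Relation.ReflTransGen (MovedAdj γ) x y →
      Relation.ReflTransGen (MovedAdj γ) y x := by
    intro x y h
    have : Std.Symm (MovedAdj γ) := ⟨fun _ _ h => h.symm⟩
    exact symm h
  have hmoved : ∀ x ∈ D, γ x ≠ x := by
    intro x hx
    rcases Relation.ReflTransGen.cases_tail hx with h | ⟨w, _, h⟩
    · rw [h]; exact hz
    · exact h.2.2
  have hγmap : ∀ {x y}, Relation.ReflTransGen (MovedAdj γ) x y →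
      Relation.ReflTransGen (MovedAdj γ) (γ x) (γ y) := fun h =>
    h.lift γ fun _ _ h => h.map
  have hmemD' : ∀ y, y ∈ γ '' D ↔ Relation.ReflTransGen (MovedAdj γ) (γ z) y := by
    intro y
    constructor
    · rintro ⟨x, hx, rfl⟩
      exact hγmap hx
    · intro h
      have h2 : Relation.ReflTransGen (MovedAdj γ) (γ.symm (γ z)) (γ.symm y) :=
        h.lift γ.symm fun _ _ h => h.map_symm
      rw [RelIso.symm_apply_apply] at h2
      exact ⟨γ.symm y, h2, RelIso.apply_symm_apply _ _⟩
  have hAA : D = γ '' D ∨ Disjoint D (γ '' D) := by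
    by_cases h : Relation.ReflTransGen (MovedAdj γ) z (γ z)
    · left
      ext y
      rw [hmemD']
      exact ⟨fun hy => (hsymm h).trans hy, fun hy => h.trans hy⟩
    · right
      rw [Set.disjoint_left]
      intro y hy hy'
      rw [hmemD'] at hy'
      exact h (Relation.ReflTransGen.trans hy (hsymm hy'))
  have hfinal := hG.swap_eq_self (A := D) (A' := γ '' D) (σ := γ) (τ := γ.symm)
    (Set.mapsTo_image _ _) (by rintro _ ⟨x, hx, rfl⟩; rwa [RelIso.symm_apply_apply])
    (fun x _ => RelIso.symm_apply_apply _ _) (fun x _ => RelIso.apply_symm_apply _ _) hAA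
    (fun x _ y _ => γ.map_adj_iff) ?_ ?_ hfin (fun v hv => hdeg v hv) ?_ z
      Relation.ReflTransGen.refl
  · exact hz hfinal
  · intro x hx w hw hw'
    constructor
    · intro h
      by_cases hm : γ w = w
      · rw [← hm, γ.map_adj_iff] at h; exact h
      · refine absurd ?_ hw'
        rw [hmemD']
        exact (hγmap hx).tail ⟨h, fun h' => hmoved x hx (γ.injective h'), hm⟩
    · intro h
      by_cases hm : γ w = w
      · rw [← hm, γ.map_adj_iff]; exact h
      · exact absurd (Relation.ReflTransGen.tail hx ⟨h, hmoved x hx, hm⟩) hw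
  · rintro hd x hx y ⟨w, hw, rfl⟩ h
    refine Set.disjoint_left.1 hd ?_ ⟨w, hw, rfl⟩
    exact Relation.ReflTransGen.tail hx ⟨h, hmoved x hx, fun h' => hmoved w hw (γ.injective h')⟩
  · rintro _ ⟨w, hw, rfl⟩
    refine ((hdeg w hw).image γ).subset fun u hu => ⟨γ.symm u, ?_, RelIso.apply_symm_apply _ _⟩
    have : G.Adj (γ w) (γ (γ.symm u)) := by rw [RelIso.apply_symm_apply]; exact hu
    exact γ.map_adj_iff.1 this

end EdgeColouring

/-! ### Normal spanning trees of countable connected graphs -/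

namespace EdgeColouring
variable {V : Type*} {G : SimpleGraph V}

/-- A normal spanning tree of `G`, given by its parent and level functions. -/
structure NormalTree (G : SimpleGraph V) where
  root : V
  par : V → V
  lev : V → ℕ
  par_root : par root = root
  lev_root : lev root = 0
  lev_par : ∀ v, v ≠ root → lev v = lev (par v) + 1
  adj_par : ∀ v, v ≠ root → G.Adj (par v) v
  normal : ∀ x y, G.Adj x y → (∃ k, par^[k] y = x) ∨ ∃ k, par^[k] x = y

namespace NormalTreeConstruction

/-- The graph `G` without the edges that meet `X`. -/
def away (G : SimpleGraph V) (X : Set V) : SimpleGraph V where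
  Adj a b := G.Adj a b ∧ a ∉ X ∧ b ∉ X
  symm := ⟨fun _ _ h => ⟨h.1.symm, h.2.2, h.2.1⟩⟩
  loopless := ⟨fun _ h => h.1.ne rfl⟩

/-- The component of `y` in `away G X`. -/
def comp (G : SimpleGraph V) (X : Set V) (y : V) : Set V := {z | (away G X).Reachable y z}

/-- `w` is a neighbour of `v` in `S` that is as close as possible to the first vertex of `S`. -/
def IsNext (G : SimpleGraph V) (idx : V → ℕ) (X : Set V) (v : V) (S : Set V) (w : V) : Prop :=
  w ∈ S ∧ G.Adj v w ∧ ∃ t ∈ S, (∀ s ∈ S, idx t ≤ idx s) ∧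
    ∀ w' ∈ S, G.Adj v w' → (away G X).dist w t ≤ (away G X).dist w' t

/-- The vertices placed on the branch towards `y` after `n` steps, and the last one placed. -/
noncomputable def st (G : SimpleGraph V) (idx : V → ℕ) (r y : V) : ℕ → Set V × V
  | 0 => ({r}, r)
  | n + 1 =>
    let s := st G idx r y n
    let w := @Classical.epsilon V ⟨r⟩ (IsNext G idx s.1 s.2 (comp G s.1 y))
    (insert w s.1, w)

variable {idx : V → ℕ} {r : V}

theorem away_mono {X Y : Set V} (h : X ⊆ Y) : away G Y ≤ away G X :=
  fun _ _ hab => ⟨hab.1, fun h' => hab.2.1 (h h'), fun h' => hab.2.2 (h h')⟩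

theorem comp_anti {X Y : Set V} (h : X ⊆ Y) (y : V) : comp G Y y ⊆ comp G X y :=
  fun _ hz => SimpleGraph.Reachable.mono (away_mono h) hz

theorem comp_eq_of_mem {X : Set V} {y z : V} (h : z ∈ comp G X y) : comp G X z = comp G X y := by
  ext u
  exact ⟨fun hu => SimpleGraph.Reachable.trans h hu,
    fun hu => SimpleGraph.Reachable.trans (SimpleGraph.Reachable.symm h) hu⟩

theorem notMem_of_mem_comp {X : Set V} {y z : V} (h : z ∈ comp G X y) (hy : y ∉ X) : z ∉ X := by
  obtain ⟨p⟩ := h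
  induction p with
  | nil => exact hy
  | cons h _ ih => exact ih h.2.2

theorem st_succ_fst (y : V) (n : ℕ) :
    (st G idx r y (n + 1)).1 = insert (st G idx r y (n + 1)).2 (st G idx r y n).1 := rfl

theorem st_fst_mono (y : V) : Monotone fun n => (st G idx r y n).1 :=
  monotone_nat_of_le_succ fun n => by
    rw [st_succ_fst]; exact Set.subset_insert _ _

/-- The construction depends on `y` only through its component off the vertices already placed, so
the branches towards two vertices agree as long as these are not separated. -/
theorem st_eq_of_mem_comp {y z : V} {n : ℕ} (h : z ∈ comp G (st G idx r y n).1 y) :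
    ∀ k ≤ n + 1, st G idx r z k = st G idx r y k := by
  intro k
  induction k with
  | zero => intro _; rfl
  | succ k ih =>
    intro hk
    have hk' : k ≤ n := Nat.le_of_succ_le_succ hk
    have hz : z ∈ comp G (st G idx r y k).1 y := comp_anti (st_fst_mono y hk') y h
    simp only [st]
    rw [ih (by lia), comp_eq_of_mem hz]

theorem exists_adj_of_walk {X : Set V} {y w : V} (p : (away G X).Walk y w) (h : y ≠ w) :
    ∃ u ∈ comp G (insert w X) y, G.Adj w u := by
  induction p with
  | nil => exact absurd rfl h
  | @cons a b c hab p ih =>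
    by_cases hb : b = c
    · subst hb
      exact ⟨a, SimpleGraph.Reachable.refl _, hab.1.symm⟩
    · obtain ⟨u, hu, hcu⟩ := ih hb
      refine ⟨u, SimpleGraph.Reachable.trans ?_ hu, hcu⟩
      refine SimpleGraph.Adj.reachable ⟨hab.1, ?_, ?_⟩
      · simp only [Set.mem_insert_iff, not_or]; exact ⟨h, hab.2.1⟩
      · simp only [Set.mem_insert_iff, not_or]; exact ⟨hb, hab.2.2⟩

theorem exists_walk_insert {X : Set V} {w a b : V} (p : (away G X).Walk a b)
    (hw : w ∉ p.support) : ∃ q : (away G (insert w X)).Walk a b, q.length = p.length := by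
  induction p with
  | nil => exact ⟨.nil, rfl⟩
  | @cons a b c hab p ih =>
    rw [SimpleGraph.Walk.support_cons, List.mem_cons, not_or] at hw
    obtain ⟨q, hq⟩ := ih hw.2
    have h1 : a ∉ insert w X := by
      simp only [Set.mem_insert_iff, not_or]; exact ⟨Ne.symm hw.1, hab.2.1⟩
    have h2 : b ∉ insert w X := by
      simp only [Set.mem_insert_iff, not_or]
      exact ⟨fun h => hw.2 (h ▸ p.start_mem_support), hab.2.2⟩
    have h3 : (away G (insert w X)).Adj a b := ⟨hab.1, h1, h2⟩
    exact ⟨.cons h3 q, by rw [SimpleGraph.Walk.length_cons, SimpleGraph.Walk.length_cons, hq]⟩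

theorem exists_shorter_walk {X : Set V} {w t : V} (h : (away G X).Reachable w t) (ht : t ≠ w) :
    ∃ u, G.Adj w u ∧ ∃ q : (away G (insert w X)).Walk u t, q.length < (away G X).dist w t := by
  obtain ⟨p, hp, hlen⟩ := h.exists_path_of_dist
  rw [← hlen]
  cases p with
  | nil => exact absurd rfl ht
  | @cons _ u _ hau p =>
    rw [SimpleGraph.Walk.cons_isPath_iff] at hp
    obtain ⟨q, hq⟩ := exists_walk_insert p hp.2
    exact ⟨u, hau.1, q, by rw [hq, SimpleGraph.Walk.length_cons]; exact Nat.lt_succ_self _⟩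

theorem exists_isNext {X S : Set V} {v : V} (h : ∃ u ∈ S, G.Adj v u) :
    ∃ w, IsNext G idx X v S w := by
  obtain ⟨u, hu, hvu⟩ := h
  obtain ⟨t, ht, htmin⟩ := exists_minimalFor_of_wellFoundedLT (· ∈ S) idx ⟨u, hu⟩
  obtain ⟨w, hw, hwmin⟩ := exists_minimalFor_of_wellFoundedLT (fun w => w ∈ S ∧ G.Adj v w)
    (fun w => (away G X).dist w t) ⟨u, hu, hvu⟩
  refine ⟨w, hw.1, hw.2, t, ht, fun s hs => ?_, fun w' hw' hvw' => ?_⟩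
  · rcases le_total (idx t) (idx s) with h | h
    exacts [h, htmin hs h]
  · rcases le_total ((away G X).dist w t) ((away G X).dist w' t) with h | h
    exacts [h, hwmin ⟨hw', hvw'⟩ h]

theorem isNext_of_exists {y : V} {n : ℕ}
    (h : ∃ u ∈ comp G (st G idx r y n).1 y, G.Adj (st G idx r y n).2 u) :
    IsNext G idx (st G idx r y n).1 (st G idx r y n).2 (comp G (st G idx r y n).1 y)
      (st G idx r y (n + 1)).2 :=
  Classical.epsilon_spec (exists_isNext h)

theorem isNext_st (hconn : G.Connected) {y : V} {n : ℕ} (h : y ∉ (st G idx r y n).1) :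
    IsNext G idx (st G idx r y n).1 (st G idx r y n).2 (comp G (st G idx r y n).1 y)
      (st G idx r y (n + 1)).2 := by
  refine isNext_of_exists ?_
  induction n with
  | zero =>
    have hle : G ≤ away G ∅ := fun _ _ h => ⟨h, Set.notMem_empty _, Set.notMem_empty _⟩
    obtain ⟨p⟩ := (hconn y r).mono hle
    have := exists_adj_of_walk p (fun h' => h (by rw [h']; exact Set.mem_singleton _))
    rwa [insert_empty_eq] at this
  | succ n ih =>
    have hn : y ∉ (st G idx r y n).1 := fun h' => h (st_fst_mono y (Nat.le_succ n) h')
    obtain ⟨p⟩ := (isNext_of_exists (ih hn)).1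
    exact exists_adj_of_walk p fun h' => h (Set.mem_insert_iff.2 (Or.inl h'))

/-- If `y` were never placed, the first vertex `t n` of its component would have an increasing index
bounded by that of `y`, so it would be constant eventually. From then on each step brings the branch
strictly closer to that vertex, which cannot go on forever. -/
theorem exists_mem_st (hconn : G.Connected) (hidx : Function.Injective idx) (y : V) :
    ∃ n, y ∈ (st G idx r y n).1 := by
  by_contra! hy
  have hnext := fun n => isNext_st (idx := idx) hconn (hy n)
  choose hmem hadj t ht htmin hdist using hnext
  have hmono : Monotone fun n => idx (t n) := monotone_nat_of_le_succ fun n =>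
    htmin n _ (comp_anti (st_fst_mono y (Nat.le_succ n)) y (ht (n + 1)))
  have hbdd : ∀ n, idx (t n) ≤ idx y := fun n => htmin n y (SimpleGraph.Reachable.refl _)
  obtain ⟨N, hN⟩ : ∃ N, ∀ n ≥ N, t n = t N := by
    obtain ⟨N, -, hN⟩ := exists_minimalFor_of_wellFoundedLT (fun _ : ℕ => True)
      (fun n => idx y - idx (t n)) ⟨0, trivial⟩
    refine ⟨N, fun n hn => hidx ?_⟩
    have h1 := hmono hn
    have h2 := hbdd n
    have h3 := hbdd N
    have h4 := @hN n trivial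
    simp only at h1 h4
    lia
  have hdec : ∀ n ≥ N, (away G (st G idx r y (n + 1)).1).dist (st G idx r y (n + 2)).2 (t N) <
      (away G (st G idx r y n).1).dist (st G idx r y (n + 1)).2 (t N) := by
    intro n hn
    have h1 : t N ∈ comp G (st G idx r y n).1 y := hN n hn ▸ ht n
    have h2 : t N ∈ comp G (st G idx r y (n + 1)).1 y := hN (n + 1) (by lia) ▸ ht (n + 1)
    have h3 : t N ∉ (st G idx r y (n + 1)).1 := notMem_of_mem_comp h2 (hy _)
    have h5 : t N ≠ (st G idx r y (n + 1)).2 :=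
      fun h => h3 (Set.mem_insert_iff.2 (Or.inl h))
    -- A shortest path to the target leaves the vertex just placed and never returns, so its second
    -- vertex is a competitor for the next choice.
    obtain ⟨u, hau, q, hq⟩ := exists_shorter_walk
      (SimpleGraph.Reachable.trans (SimpleGraph.Reachable.symm (hmem n)) h1) h5
    have h4 := hdist (n + 1) u (SimpleGraph.Reachable.trans h2
      (SimpleGraph.Reachable.symm ⟨q⟩)) hau
    rw [hN (n + 1) (by lia)] at h4
    exact (h4.trans (SimpleGraph.dist_le q)).trans_lt hq
  have hlt : ∀ k, (away G (st G idx r y (N + k)).1).dist (st G idx r y (N + k + 1)).2 (t N) + k ≤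
      (away G (st G idx r y N).1).dist (st G idx r y (N + 1)).2 (t N) := by
    intro k
    induction k with
    | zero => simp
    | succ k ih =>
      have := hdec (N + k) (by lia)
      rw [← add_assoc]
      lia
  have := hlt ((away G (st G idx r y N).1).dist (st G idx r y (N + 1)).2 (t N) + 1)
  lia

end NormalTreeConstruction

-- The level of `y` is the step at which `y` is placed, and its parent is the vertex placed just
-- before. Normality holds because adjacent vertices stay in one component until the first of them
-- is placed.
open NormalTreeConstruction in
theorem exists_normalTree [Countable V] (hconn : G.Connected) (r : V) :
    ∃ T : NormalTree G, T.root = r := by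
  classical
  obtain ⟨idx, hidx⟩ := exists_injective_nat V
  have hterm := exists_mem_st (G := G) (r := r) hconn hidx
  let s := st G idx r
  let lev : V → ℕ := fun y => Nat.find (hterm y)
  have hlev_mem : ∀ y, y ∈ (s y (lev y)).1 := fun y => Nat.find_spec (hterm y)
  have hlev_not : ∀ y k, k < lev y → y ∉ (s y k).1 := fun y k hk => Nat.find_min (hterm y) hk
  have hlev_eq : ∀ y k, y ∈ (s y k).1 → (∀ j < k, y ∉ (s y j).1) → lev y = k := fun y k h h' =>
    (Nat.find_eq_iff (hterm y)).2 ⟨h, h'⟩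
  have hlast : ∀ y, (s y (lev y)).2 = y := by
    intro y
    have h1 := hlev_mem y
    rcases hk : lev y with _ | k
    · rw [hk] at h1
      exact (Set.mem_singleton_iff.1 h1).symm
    · rw [hk, st_succ_fst] at h1
      rcases Set.mem_insert_iff.1 h1 with h2 | h2
      · exact h2.symm
      · exact absurd h2 (hlev_not y k (by lia))
  have hroot : lev r = 0 := hlev_eq r 0 (Set.mem_singleton _) (by simp)
  have hanc : ∀ y k, k ≤ lev y → lev (s y k).2 = k ∧ ∀ j ≤ k, s (s y k).2 j = s y j := by
    intro y k hk
    rcases k with _ | k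
    · refine ⟨hroot, fun j hj => ?_⟩
      rw [Nat.le_zero.1 hj]; rfl
    · have hyk := hlev_not y k (by lia)
      have hmem := (isNext_st (idx := idx) hconn hyk).1
      have hst := st_eq_of_mem_comp hmem
      refine ⟨hlev_eq _ _ ?_ ?_, hst⟩
      · change _ ∈ (st G idx r _ (k + 1)).1
        rw [hst (k + 1) le_rfl, st_succ_fst]
        exact Set.mem_insert _ _
      · intro j hj
        change _ ∉ (st G idx r _ j).1
        rw [hst j (by lia)]
        exact fun h => notMem_of_mem_comp hmem hyk (st_fst_mono y (by lia) h)
  let par : V → V := fun y => (s y (lev y - 1)).2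
  have hiter : ∀ y j, par^[j] y = (s y (lev y - j)).2 := by
    intro y j
    induction j with
    | zero => exact (hlast y).symm
    | succ j ih =>
      rw [Function.iterate_succ_apply', ih]
      obtain ⟨h1, h2⟩ := hanc y (lev y - j) (by lia)
      change (s _ (lev _ - 1)).2 = _
      rw [h1, h2 _ (by lia), Nat.sub_sub]
  have hnr : ∀ y, y ≠ r → lev y ≠ 0 := by
    intro y hy h
    have := hlast y
    rw [h] at this
    exact hy this.symm
  have hnorm : ∀ x y, G.Adj x y → lev x ≤ lev y → ∃ k, par^[k] y = x := by
    intro x y hxy hle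
    have hst : ∀ k ≤ lev x, s x k = s y k := by
      intro k
      induction k with
      | zero => intro _; rfl
      | succ k ih =>
        intro hk
        have h1 := ih (by lia)
        refine st_eq_of_mem_comp (n := k) ?_ (k + 1) le_rfl
        refine SimpleGraph.Adj.reachable ⟨hxy.symm, hlev_not y k (by lia), ?_⟩
        change x ∉ (s y k).1
        rw [← h1]
        exact hlev_not x k (by lia)
    refine ⟨lev y - lev x, ?_⟩
    rw [hiter, Nat.sub_sub_self hle, ← hst _ le_rfl, hlast]
  refine ⟨⟨r, par, lev, ?_, hroot, ?_, ?_, ?_⟩, rfl⟩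
  · change (s r (lev r - 1)).2 = r
    rw [hroot]; rfl
  · intro y hy
    have := hnr y hy
    have h2 := (hanc y (lev y - 1) (by lia)).1
    change lev y = lev (s y (lev y - 1)).2 + 1
    lia
  · intro y hy
    have h1 := hnr y hy
    have h2 := (isNext_st (idx := idx) hconn (hlev_not y (lev y - 1) (by lia))).2.1
    rw [Nat.sub_add_cancel (by lia)] at h2
    have h3 := hlast y
    change (st G idx r y (lev y)).2 = y at h3
    rw [h3] at h2
    exact h2
  · intro x y hxy
    rcases le_total (lev x) (lev y) with h | h
    · exact Or.inl (hnorm x y hxy h)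
    · exact Or.inr (hnorm y x hxy.symm h)

end EdgeColouring

/-! ### The tree order and the size of branches -/

namespace EdgeColouring
variable {V : Type*} {G : SimpleGraph V}

namespace NormalTree

variable (T : NormalTree G)

/-- `x` is an ancestor of `y` or equal to `y`. -/
def Le (x y : V) : Prop := ∃ k, T.par^[k] y = x

/-- The vertices above `v`. -/
def up (v : V) : Set V := {y | T.Le v y}

variable {T} {u v w x y z : V}

theorem le_refl (x : V) : T.Le x x := ⟨0, rfl⟩

theorem Le.trans (h : T.Le x y) (h' : T.Le y z) : T.Le x z := by
  obtain ⟨k, rfl⟩ := h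
  obtain ⟨l, rfl⟩ := h'
  exact ⟨k + l, Function.iterate_add_apply _ _ _ _⟩

theorem lev_par' (v : V) : T.lev (T.par v) = T.lev v - 1 := by
  by_cases h : v = T.root
  · rw [h, T.par_root, T.lev_root]
  · rw [T.lev_par v h]; rfl

theorem lev_iterate (k : ℕ) (y : V) : T.lev (T.par^[k] y) = T.lev y - k := by
  induction k with
  | zero => rfl
  | succ k ih => rw [Function.iterate_succ_apply', lev_par', ih, Nat.sub_sub]

theorem eq_root_of_lev (h : T.lev v = 0) : v = T.root := by
  by_contra hv
  have := T.lev_par v hv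
  lia

theorem root_le (v : V) : T.Le T.root v :=
  ⟨T.lev v, eq_root_of_lev (by rw [lev_iterate, Nat.sub_self])⟩

theorem Le.iterate_eq (h : T.Le x y) : T.par^[T.lev y - T.lev x] y = x := by
  obtain ⟨k, rfl⟩ := h
  rcases le_total k (T.lev y) with h | h
  · rw [lev_iterate, Nat.sub_sub_self h]
  · rw [eq_root_of_lev (v := T.par^[k] y) (by rw [lev_iterate]; lia), T.lev_root]
    exact eq_root_of_lev (by rw [lev_iterate, Nat.sub_zero, Nat.sub_self])

theorem Le.lev_le (h : T.Le x y) : T.lev x ≤ T.lev y := by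
  obtain ⟨k, rfl⟩ := h
  rw [lev_iterate]
  exact Nat.sub_le _ _

theorem Le.eq_of_lev (h : T.Le x y) (h' : T.lev y ≤ T.lev x) : x = y := by
  rw [← h.iterate_eq, Nat.sub_eq_zero_of_le h', Function.iterate_zero, id]

theorem Le.antisymm (h : T.Le x y) (h' : T.Le y x) : x = y := h.eq_of_lev h'.lev_le

theorem Le.lev_lt (h : T.Le x y) (hne : x ≠ y) : T.lev x < T.lev y :=
  lt_of_not_ge fun h' => hne (h.eq_of_lev h')

theorem Le.of_lev_le (hx : T.Le x z) (hy : T.Le y z) (h : T.lev x ≤ T.lev y) : T.Le x y := by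
  refine ⟨T.lev y - T.lev x, ?_⟩
  have h1 := hx.iterate_eq
  have h2 := hy.iterate_eq
  have h3 := hy.lev_le
  rw [← h2, ← Function.iterate_add_apply, ← h1, ← h2]
  congr 2
  rw [h1, h2]
  lia

theorem Le.total (hx : T.Le x z) (hy : T.Le y z) : T.Le x y ∨ T.Le y x :=
  (le_total (T.lev x) (T.lev y)).imp (hx.of_lev_le hy) (hy.of_lev_le hx)

theorem par_le (v : V) : T.Le (T.par v) v := ⟨1, rfl⟩

theorem Le.le_par (h : T.Le x y) (hne : x ≠ y) : T.Le x (T.par y) := by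
  obtain ⟨k, rfl⟩ := h
  cases k with
  | zero => exact absurd rfl hne
  | succ k => exact ⟨k, rfl⟩

theorem Le.ne_root (h : T.Le x y) (hne : x ≠ y) : y ≠ T.root := by
  rintro rfl
  exact hne (h.antisymm (root_le x))

theorem par_ne (h : v ≠ T.root) : T.par v ≠ v := (T.adj_par v h).ne

theorem not_le_par (h : v ≠ T.root) : ¬ T.Le v (T.par v) := fun h' => by
  have := h'.lev_le
  have := T.lev_par v h
  lia

theorem Le.exists_child (h : T.Le x y) (hne : x ≠ y) :
    ∃ c, c ≠ T.root ∧ T.par c = x ∧ T.Le c y := by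
  have h1 := h.iterate_eq
  have h2 := h.lev_lt hne
  have hs : T.lev y - T.lev x = (T.lev y - T.lev x - 1) + 1 := by lia
  rw [hs, Function.iterate_succ_apply'] at h1
  refine ⟨_, fun h0 => ?_, h1, _, rfl⟩
  have h3 := lev_iterate (T := T) (T.lev y - T.lev x - 1) y
  rw [h0, T.lev_root] at h3
  lia

theorem finite_le (y : V) : {x | T.Le x y}.Finite := by
  refine ((Set.finite_Iic (T.lev y)).image fun k => T.par^[k] y).subset fun x hx => ?_
  exact ⟨T.lev y - T.lev x, Nat.sub_le _ _, Le.iterate_eq hx⟩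

theorem comparable_of_adj (h : G.Adj x y) : T.Le x y ∨ T.Le y x := T.normal x y h

theorem Le.le_or_of_adj (h : G.Adj x y) (hx : T.Le v x) (hy : ¬ T.Le v y) : T.Le y v ∧ y ≠ v := by
  have hyv : y ≠ v := fun h' => hy (h' ▸ le_refl y)
  refine ⟨?_, hyv⟩
  rcases comparable_of_adj (T := T) h with h1 | h1
  · exact absurd (hx.trans h1) hy
  · exact (h1.total hx).resolve_right hy

theorem neighborSet_subset (hx : T.Le v x) :
    G.neighborSet x ⊆ T.up v ∪ {z | T.Le z v} := fun z hz => by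
  by_cases h : T.Le v z
  · exact Or.inl h
  · exact Or.inr (hx.le_or_of_adj hz h).1

theorem finite_neighborSet (hv : (T.up v).Finite) (hx : T.Le v x) : (G.neighborSet x).Finite :=
  (hv.union (finite_le v)).subset (neighborSet_subset hx)

theorem up_mono (h : T.Le x y) : T.up y ⊆ T.up x := fun _ hz => h.trans hz

theorem disjoint_up (h : ¬ T.Le x y) (h' : ¬ T.Le y x) : Disjoint (T.up x) (T.up y) :=
  Set.disjoint_left.2 fun _ hx hy => (hx.total hy).elim h h'

theorem disjoint_up_of_lev (h : T.lev x = T.lev y) (hne : x ≠ y) : Disjoint (T.up x) (T.up y) :=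
  disjoint_up (fun h' => hne (h'.eq_of_lev h.ge)) fun h' => hne (h'.eq_of_lev h.le).symm

theorem up_eq : T.up v = {v} ∪ ⋃ c ∈ {c | c ≠ T.root ∧ T.par c = v}, T.up c := by
  ext y
  simp only [Set.mem_union, Set.mem_iUnion, Set.mem_singleton_iff]
  constructor
  · intro h
    by_cases hvy : v = y
    · exact Or.inl hvy.symm
    · obtain ⟨c, h1, h2, h3⟩ := Le.exists_child h hvy
      exact Or.inr ⟨c, ⟨h1, h2⟩, h3⟩
  · rintro (rfl | ⟨c, ⟨-, rfl⟩, h⟩)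
    · exact le_refl _
    · exact (par_le c).trans h

/-- The adjacency pattern of the branch at `u`, read off through the labelling `e`. -/
def code (T : NormalTree G) {n : ℕ} (e : V → Fin n) (ℓ : ℕ) (u : V) :
    Set (Fin n) × Set (Fin n × Fin n) × Set (Fin n × Fin ℓ) :=
  (e '' T.up u, {p | ∃ x ∈ T.up u, ∃ y ∈ T.up u, (e x, e y) = p ∧ G.Adj x y},
    {p | ∃ x ∈ T.up u, e x = p.1 ∧ G.Adj x (T.par^[p.2] (T.par u))})

/-- Equal codes of two finite sibling branches give an isomorphism that respects adjacency to all
common ancestors. By normality there are no edges between the branches and no other outside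
neighbours, so distinct siblings could be swapped. -/
theorem eq_of_code_eq (hG : HasInfiniteEdgeMotion G) {n : ℕ} {e e' : V → Fin n} {u u' : V}
    (hu : u ≠ T.root) (hu' : u' ≠ T.root) (hp : T.par u = T.par u')
    (he : Set.InjOn e (T.up u)) (he' : Set.InjOn e' (T.up u'))
    (hcode : T.code e (T.lev (T.par u) + 1) u = T.code e' (T.lev (T.par u) + 1) u')
    (hfin : (T.up u).Finite) (hfin' : (T.up u').Finite) : u = u' := by
  classical
  by_contra hne
  have hlev : T.lev u = T.lev u' := by rw [T.lev_par u hu, T.lev_par u' hu', hp]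
  have hdisj := disjoint_up_of_lev hlev hne
  simp only [code, Prod.mk.injEq] at hcode
  obtain ⟨h1, h2, h3⟩ := hcode
  have hex : ∀ x ∈ T.up u, ∃ y ∈ T.up u', e' y = e x := fun x hx => by
    have : e x ∈ e '' T.up u := ⟨x, hx, rfl⟩
    rwa [h1] at this
  have hex' : ∀ x ∈ T.up u', ∃ y ∈ T.up u, e y = e' x := fun x hx => by
    have : e' x ∈ e' '' T.up u' := ⟨x, hx, rfl⟩
    rwa [← h1] at this
  choose! σ hσ hσe using hex
  choose! τ hτ hτe using hex'
  have hanc : ∀ {u₁ x z}, u₁ ≠ T.root → T.par u₁ = T.par u → x ∈ T.up u₁ → z ∉ T.up u₁ →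
      G.Adj x z → ∃ j : Fin (T.lev (T.par u) + 1), T.par^[j] (T.par u) = z := by
    intro u₁ x z _ hpu hx hz hadj
    obtain ⟨h4, h5⟩ := Le.le_or_of_adj hadj hx hz
    have h6 := h4.le_par h5
    rw [hpu] at h6
    -- Ancestors are counted downwards from the parent, which has position 0; there are `T.lev
    -- (T.par u) + 1` of them.
    exact ⟨⟨T.lev (T.par u) - T.lev z, by lia⟩, h6.iterate_eq⟩
  have hself := hG.swap_eq_self (A := T.up u) (A' := T.up u') (σ := σ) (τ := τ)
    (fun x hx => hσ x hx) (fun x hx => hτ x hx)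
    (fun x hx => he (hτ _ (hσ x hx)) hx (by rw [hτe _ (hσ x hx), hσe x hx]))
    (fun x hx => he' (hσ _ (hτ x hx)) hx (by rw [hσe _ (hτ x hx), hτe x hx]))
    (Or.inr hdisj) ?_ ?_ ?_ hfin (fun v hv => finite_neighborSet hfin hv)
    (fun v hv => finite_neighborSet hfin' hv) u (le_refl u)
  · exact Set.disjoint_left.1 hdisj (le_refl u) (hself ▸ hσ u (le_refl u))
  · intro x hx y hy
    constructor
    · intro h
      have : (e x, e y) ∈ {p | ∃ x ∈ T.up u', ∃ y ∈ T.up u', (e' x, e' y) = p ∧ G.Adj x y} :=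
        ⟨σ x, hσ x hx, σ y, hσ y hy, by rw [hσe x hx, hσe y hy], h⟩
      rw [← h2] at this
      obtain ⟨x', hx', y', hy', h4, h5⟩ := this
      rw [Prod.mk.injEq] at h4
      rwa [he hx' hx h4.1, he hy' hy h4.2] at h5
    · intro h
      have : (e x, e y) ∈ {p | ∃ x ∈ T.up u, ∃ y ∈ T.up u, (e x, e y) = p ∧ G.Adj x y} :=
        ⟨x, hx, y, hy, rfl, h⟩
      rw [h2] at this
      obtain ⟨x', hx', y', hy', h4, h5⟩ := this
      rw [Prod.mk.injEq] at h4
      rwa [he' hx' (hσ x hx) (h4.1.trans (hσe x hx).symm),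
        he' hy' (hσ y hy) (h4.2.trans (hσe y hy).symm)] at h5
  · intro x hx z hz hz'
    constructor
    · intro h
      obtain ⟨j, rfl⟩ := hanc hu' hp.symm (hσ x hx) hz' h
      have : (e x, j) ∈ {p : Fin n × Fin (T.lev (T.par u) + 1) |
          ∃ x ∈ T.up u', e' x = p.1 ∧ G.Adj x (T.par^[p.2] (T.par u'))} :=
        ⟨σ x, hσ x hx, hσe x hx, hp ▸ h⟩
      rw [← h3] at this
      obtain ⟨x', hx', h4, h5⟩ := this
      rwa [he hx' hx h4] at h5
    · intro h
      obtain ⟨j, rfl⟩ := hanc hu rfl hx hz h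
      have : (e x, j) ∈ {p : Fin n × Fin (T.lev (T.par u) + 1) |
          ∃ x ∈ T.up u, e x = p.1 ∧ G.Adj x (T.par^[p.2] (T.par u))} :=
        ⟨x, hx, rfl, h⟩
      rw [h3] at this
      obtain ⟨x', hx', h4, h5⟩ := this
      rw [he' hx' (hσ x hx) (h4.trans (hσe x hx).symm), ← hp] at h5
      exact h5
  · intro _ x hx y hy h
    have hy' : ¬ T.Le u y := fun h' => Set.disjoint_left.1 hdisj h' hy
    have h4 := (Le.le_or_of_adj h hx hy').1
    exact hne ((hy.trans h4).eq_of_lev hlev.le).symm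

/-- Induction on the height. Branches at the children have uniformly bounded size, so only finitely
many codes occur, and siblings have different codes. The bound must be uniform in `v`, which is why
it may depend only on the level and the height. -/
theorem exists_ncard_up_le (hG : HasInfiniteEdgeMotion G) (T : NormalTree G) (n : ℕ) :
    ∀ ℓ, ∃ B, ∀ v, T.lev v = ℓ → (∀ y, T.Le v y → T.lev y ≤ ℓ + n) →
      (T.up v).Finite ∧ (T.up v).ncard ≤ B := by
  classical
  induction n with
  | zero =>
    refine fun ℓ => ⟨1, fun v hv h => ?_⟩
    have : T.up v = {v} := by
      ext y
      refine ⟨fun hy => (hy.eq_of_lev ?_).symm, fun hy => hy ▸ le_refl v⟩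
      have := h y hy
      lia
    rw [this]
    exact ⟨Set.finite_singleton v, (Set.ncard_singleton v).le⟩
  | succ n ih =>
    intro ℓ
    obtain ⟨B, hB⟩ := ih (ℓ + 1)
    -- One label more than necessary keeps the label set nonempty when `B = 0`.
    let K := Set (Fin (B + 1)) × Set (Fin (B + 1) × Fin (B + 1)) × Set (Fin (B + 1) × Fin (ℓ + 1))
    refine ⟨1 + Fintype.card K * B, fun v hv h => ?_⟩
    let S : Set V := {c | c ≠ T.root ∧ T.par c = v}
    have hS : ∀ c ∈ S, (T.up c).Finite ∧ (T.up c).ncard ≤ B := by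
      rintro c ⟨hc, rfl⟩
      refine hB c (by rw [T.lev_par c hc, hv]) fun y hy => ?_
      have := h y ((par_le c).trans hy)
      lia
    have hinj : ∀ c ∈ S, ∃ e : V → Fin (B + 1), Set.InjOn e (T.up c) := by
      intro c hc
      obtain ⟨h1, h2⟩ := hS c hc
      obtain ⟨e, -, he⟩ := h1.exists_injOn_of_encard_le
        (t := (Set.univ : Set (Fin (B + 1)))) (by
          rw [← h1.cast_ncard_eq, Set.encard_univ, ENat.card_eq_coe_fintype_card,
            Fintype.card_fin]
          exact_mod_cast h2.trans (Nat.le_succ B))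
      exact ⟨e, he⟩
    choose! e he using hinj
    have hcode : Set.InjOn (fun c => T.code (e c) (ℓ + 1) c) S := by
      rintro c hc c' hc' hcc
      refine eq_of_code_eq hG hc.1 hc'.1 (hc.2.trans hc'.2.symm) (he c hc) (he c' hc') ?_
        (hS c hc).1 (hS c' hc').1
      rw [hc.2, hv]
      exact hcc
    have hSfin : S.Finite := Set.Finite.of_finite_image (Set.toFinite _) hcode
    have hScard : S.ncard ≤ Fintype.card K := by
      rw [← hcode.ncard_image, ← Nat.card_eq_fintype_card, ← Set.ncard_univ]
      exact Set.ncard_le_ncard (Set.subset_univ _) Set.finite_univ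
    have hfin : (⋃ c ∈ S, T.up c).Finite := hSfin.biUnion fun c hc => (hS c hc).1
    refine ⟨?_, ?_⟩
    · rw [up_eq]
      exact (Set.finite_singleton v).union hfin
    · rw [up_eq]
      refine (Set.ncard_union_le _ _).trans ?_
      rw [Set.ncard_singleton]
      refine Nat.add_le_add_left ?_ 1
      have h1 : (⋃ c ∈ S, T.up c).ncard ≤ S.ncard * B := by
        have h2 : (⋃ c ∈ S, T.up c) =
            ↑(hSfin.toFinset.biUnion fun c => if hc : c ∈ S then (hS c hc).1.toFinset else ∅) := by
          ext y
          simp only [Set.mem_iUnion, Finset.coe_biUnion, Finset.mem_coe,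
            Set.Finite.mem_toFinset]
          refine exists_congr fun c => exists_congr fun hc => ?_
          rw [dif_pos hc, Set.Finite.mem_toFinset]
        rw [h2, Set.ncard_coe_finset, Set.ncard_eq_toFinset_card S hSfin]
        refine Finset.card_biUnion_le_card_mul _ _ _ fun c hc => ?_
        rw [Set.Finite.mem_toFinset] at hc
        rw [dif_pos hc, ← Set.ncard_eq_toFinset_card _ (hS c hc).1]
        exact (hS c hc).2
      exact h1.trans (Nat.mul_le_mul_right B hScard)

theorem exists_le_lev_gt (hG : HasInfiniteEdgeMotion G) (hv : (T.up v).Infinite) (N : ℕ) :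
    ∃ y, T.Le v y ∧ N < T.lev y := by
  by_contra! h
  obtain ⟨B, hB⟩ := exists_ncard_up_le hG T N (T.lev v)
  exact hv (hB v rfl fun y hy => (h y hy).trans (Nat.le_add_left _ _)).1

end NormalTree
end EdgeColouring

/-! ### Flags and colour classes -/

namespace EdgeColouring
variable {V : Type*} {G : SimpleGraph V}

namespace NormalTree

/-- The tree edges of a normal spanning tree. -/
def graph (T : NormalTree G) : SimpleGraph V where
  Adj x y := (y ≠ T.root ∧ T.par y = x) ∨ (x ≠ T.root ∧ T.par x = y)
  symm := ⟨fun _ _ h => h.symm⟩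
  loopless := ⟨fun _ h => h.elim (fun h => par_ne h.1 h.2) fun h => par_ne h.1 h.2⟩

/-- The neighbours of `x` along edges outside the tree. -/
def coNbrs (T : NormalTree G) (x : V) : Set V := {y | G.Adj x y ∧ ¬ T.graph.Adj x y}

variable {T : NormalTree G} {u v w x y z : V}

theorem graph_le : T.graph ≤ G := by
  rintro x y (⟨h, rfl⟩ | ⟨h, rfl⟩)
  exacts [T.adj_par y h, (T.adj_par x h).symm]

theorem Le.graph_adj (h : T.Le x y) (ha : T.graph.Adj x y) : y ≠ T.root ∧ T.par y = x := by
  rcases ha with h' | ⟨h', rfl⟩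
  · exact h'
  · exact absurd h (not_le_par h')

theorem graph_adj_par (h : v ≠ T.root) : T.graph.Adj (T.par v) v := Or.inl ⟨h, rfl⟩

/-- A tree edge that enters `up v` is the edge from the parent of `v` to `v`. -/
theorem graph_adj_enter (h : T.graph.Adj x y) (hx : ¬ T.Le v x) (hy : T.Le v y) :
    y = v ∧ T.par v = x ∧ v ≠ T.root := by
  rcases h with ⟨h, rfl⟩ | ⟨h, rfl⟩
  · by_cases hv : v = y
    · exact ⟨hv.symm, hv ▸ rfl, hv ▸ h⟩
    · exact absurd (hy.le_par hv) hx
  · exact absurd (hy.trans (par_le x)) hx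

theorem Le.exists_crossing (h : T.Le x y) {S : Set V} (hx : x ∈ S) (hy : y ∉ S) :
    ∃ z, z ≠ T.root ∧ T.par z ∈ S ∧ z ∉ S ∧ T.Le x (T.par z) ∧ T.Le z y := by
  obtain ⟨k, hk⟩ := h
  induction k generalizing y with
  | zero => exact absurd (show y ∈ S from (show y = x from hk) ▸ hx) hy
  | succ k ih =>
    rw [Function.iterate_succ_apply] at hk
    by_cases hp : T.par y ∈ S
    · refine ⟨y, ?_, hp, hy, ⟨k, hk⟩, le_refl y⟩
      intro h'
      rw [h', T.par_root] at hp
      exact hy (h' ▸ hp)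
    · obtain ⟨z, h1, h2, h3, h4, h5⟩ := ih hp hk
      exact ⟨z, h1, h2, h3, h4, h5.trans (par_le y)⟩

/-- A sequence of edges joining comparable vertices, sparsely distributed over the tree. -/
structure Flags (T : NormalTree G) where
  p : ℕ → V
  s : ℕ → V
  le : ∀ n, T.Le (p n) (s n)
  adj : ∀ n, G.Adj (p n) (s n)
  p_ne_root : ∀ n, p n ≠ T.root
  not_le : ∀ m j, m < j → ¬ T.Le (p j) (s m)
  lev_lt : ∀ i j, i < j → 3 * T.lev (s i) + j < T.lev (s j)
  cross : ∀ n, T.par (s n) = p n → ∀ a y, G.Adj a y → T.Le a (s n) → a ≠ s n → T.Le (s n) y →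
    y ≠ s n ∨ a ≠ p n → (T.coNbrs a).Infinite
  finite_p : ∀ n, T.par (s n) = p n → (T.coNbrs (p n)).Finite
  finite_s : ∀ n, T.par (s n) = p n → (T.coNbrs (s n)).Finite

/-- A non-tree edge in the required position is taken if there is one. Otherwise all edges going up
from high vertices above `v` are tree edges, and a high tree edge is taken. Its ends then have
finitely many non-tree neighbours, all below them, whereas a lower vertex with a non-tree edge
passing over the flag must have infinitely many. -/
theorem exists_flag (hG : HasInfiniteEdgeMotion G) (hv : (T.up v).Infinite) {Y : Set V}
    (hY : Y.Finite) (N : ℕ) :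
    ∃ p s, p ∉ Y ∧ N < T.lev s ∧ T.Le v p ∧ T.Le p s ∧ G.Adj p s ∧
      (T.par s = p → (∀ a y, G.Adj a y → T.Le a s → a ≠ s → T.Le s y → y ≠ s ∨ a ≠ p →
        (T.coNbrs a).Infinite) ∧ (T.coNbrs p).Finite ∧ (T.coNbrs s).Finite) := by
  by_cases hA : ∃ p s, p ∉ Y ∧ N < T.lev s ∧ T.Le v p ∧ T.Le p s ∧ G.Adj p s ∧ T.par s ≠ p
  · obtain ⟨p, s, h1, h2, h3, h4, h5, h6⟩ := hA
    exact ⟨p, s, h1, h2, h3, h4, h5, fun h => absurd h h6⟩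
  push Not at hA
  -- Beyond the levels of `W`, no vertex of `Y` or below `v` that has only finitely many non-tree
  -- neighbours has one of them.
  let W : Set V := (Y ∪ {z | T.Le z v}) ∪
    ⋃ a ∈ {a ∈ Y ∪ {z | T.Le z v} | (T.coNbrs a).Finite}, T.coNbrs a
  have hW : W.Finite := (hY.union (finite_le v)).union
    (((hY.union (finite_le v)).subset (Set.sep_subset _ _)).biUnion fun a ha => ha.2)
  obtain ⟨M, hM⟩ := (hW.image T.lev).bddAbove
  have hM : ∀ w ∈ W, T.lev w ≤ M := fun w hw => hM ⟨w, hw, rfl⟩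
  obtain ⟨s, hvs, hs⟩ := exists_le_lev_gt hG hv (max M N + 2)
  have hlv : T.lev v ≤ M := hM v (Or.inl (Or.inr (le_refl v)))
  have hsr : s ≠ T.root := by rintro rfl; rw [T.lev_root] at hs; lia
  have hlp := T.lev_par s hsr
  have hvp : T.Le v (T.par s) := hvs.le_par (by rintro rfl; lia)
  have hnotY : ∀ a, M < T.lev a → a ∉ Y := fun a ha h => by
    have := hM a (Or.inl (Or.inl h)); lia
  have hfin : ∀ a, max M N < T.lev a → T.Le v a → (T.coNbrs a).Finite := by
    intro a ha hva
    refine (finite_le (T := T) a).subset fun b hb => ?_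
    rcases comparable_of_adj (T := T) hb.1 with h | h
    · have h1 := hA a b (hnotY a (by lia)) (by have := h.lev_le; lia) hva h hb.1
      refine absurd (Or.inl ⟨h.ne_root hb.1.ne, h1⟩) hb.2
    · exact h
  refine ⟨T.par s, s, hnotY _ (by lia), by lia, hvp, par_le s, T.adj_par s hsr, fun _ =>
    ⟨?_, hfin _ (by lia) hvp, hfin _ (by lia) hvs⟩⟩
  intro a y hay has hne hsy hor hafin
  have hnt : ¬ T.graph.Adj a y := by
    intro h
    obtain ⟨rfl, h2, -⟩ := graph_adj_enter (v := s) h (fun h' => hne (has.antisymm h')) hsy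
    exact hor.elim (fun h => h rfl) fun h => h h2.symm
  have hle := has.trans hsy
  have hlev := hsy.lev_le
  by_cases haY : a ∈ Y ∪ {z | T.Le z v}
  · have := hM y (Or.inr (Set.mem_biUnion (x := a) ⟨haY, hafin⟩ ⟨hay, hnt⟩))
    lia
  · rw [Set.mem_union, not_or] at haY
    have hva := (has.total hvs).resolve_left haY.2
    have := hA a y haY.1 (by lia) hva hle hay
    exact hnt (Or.inl ⟨hle.ne_root hay.ne, this⟩)

/-- The branch segment spanned by the `n`-th flag. -/
def Flags.seg (F : T.Flags) (n : ℕ) : Set V := {z | T.Le (F.p n) z ∧ T.Le z (F.s n)}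

theorem exists_flags (hG : HasInfiniteEdgeMotion G) (T : NormalTree G) (t : ℕ → V)
    (ht : ∀ n, (T.up (t n)).Infinite) : ∃ F : T.Flags, ∀ n, T.Le (t n) (F.p n) := by
  classical
  choose p s h1 h2 h3 h4 h5 h6 using fun (n : ℕ) (Y : Finset V) =>
    exists_flag hG (ht n) Y.finite_toSet (3 * Y.sup T.lev + n)
  -- `Y n` contains the root and everything below the earlier `s m`. Choosing `p n` outside it makes
  -- the segments disjoint and keeps the root out of them; its highest level bounds those of the
  -- earlier `s m`.
  let Y : ℕ → Finset V := fun n =>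
    Nat.rec {T.root} (fun n Y => Y ∪ (finite_le (T := T) (s n Y)).toFinset) n
  have hYs : ∀ n, Y (n + 1) = Y n ∪ (finite_le (T := T) (s n (Y n))).toFinset := fun n => rfl
  have hmono : Monotone Y := monotone_nat_of_le_succ fun n => by
    rw [hYs]; exact Finset.subset_union_left
  have hroot : ∀ n, T.root ∈ Y n := fun n =>
    hmono (Nat.zero_le n) (Finset.mem_singleton_self T.root)
  have hmem : ∀ m j, m < j → ∀ z, T.Le z (s m (Y m)) → z ∈ Y j := fun m j hmj z hz => by
    refine hmono (Nat.succ_le_of_lt hmj) ?_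
    rw [Nat.succ_eq_add_one, hYs, Finset.mem_union, Set.Finite.mem_toFinset]
    exact Or.inr hz
  refine ⟨⟨fun n => p n (Y n), fun n => s n (Y n), fun n => h4 _ _, fun n => h5 _ _,
    fun n h => h1 n (Y n) (h ▸ hroot n), fun m j hmj h => h1 j (Y j) (hmem m j hmj _ h),
    fun i j hij => ?_, fun n h => (h6 n (Y n) h).1, fun n h => (h6 n (Y n) h).2.1,
    fun n h => (h6 n (Y n) h).2.2⟩, fun n => h3 n (Y n)⟩
  have := h2 j (Y j)
  have h7 : T.lev (s i (Y i)) ≤ (Y j).sup T.lev := Finset.le_sup (hmem i j hij _ (le_refl _))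
  lia

namespace Flags

variable {F : T.Flags} {m n : ℕ}

theorem ne (F : T.Flags) (n : ℕ) : F.p n ≠ F.s n := (F.adj n).ne

theorem p_mem (F : T.Flags) (n : ℕ) : F.p n ∈ F.seg n := ⟨le_refl _, F.le n⟩

theorem s_mem (F : T.Flags) (n : ℕ) : F.s n ∈ F.seg n := ⟨F.le n, le_refl _⟩

theorem eq_of_mem (h : z ∈ F.seg m) (h' : z ∈ F.seg n) : m = n := by
  rcases lt_trichotomy m n with hlt | heq | hlt
  · exact absurd (h'.1.trans h.2) (F.not_le m n hlt)
  · exact heq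
  · exact absurd (h.1.trans h'.2) (F.not_le n m hlt)

theorem p_injective (F : T.Flags) : Function.Injective F.p := fun m n h =>
  eq_of_mem (F.p_mem m) (h ▸ F.p_mem n)

theorem root_notMem : T.root ∉ F.seg n := fun h =>
  F.p_ne_root n (h.1.antisymm (root_le _))

theorem seg_finite : (F.seg n).Finite := (finite_le (F.s n)).subset fun _ h => h.2

/-- The edges of the flags with index in `A`. -/
def edges (F : T.Flags) (A : Set ℕ) : SimpleGraph V where
  Adj x y := ∃ n ∈ A, (x = F.p n ∧ y = F.s n) ∨ (x = F.s n ∧ y = F.p n)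
  symm := ⟨fun _ _ ⟨n, hn, h⟩ => ⟨n, hn, h.symm.imp And.symm And.symm⟩⟩
  loopless := ⟨fun _ ⟨n, _, h⟩ => h.elim (fun h => F.ne n (h.1.symm.trans h.2))
    fun h => F.ne n (h.2.symm.trans h.1)⟩

/-- The colour class of the colouring that swaps the two colours, given by the tree and its
complement, on the flags with index in `A`. -/
def col (F : T.Flags) (A : Set ℕ) : SimpleGraph V where
  Adj x y := Xor (T.graph.Adj x y) ((F.edges A).Adj x y)
  symm := ⟨fun _ _ h => by rwa [T.graph.adj_comm, (F.edges A).adj_comm]⟩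
  loopless := ⟨fun _ h => h.elim (fun h => h.1.ne rfl) fun h => h.1.ne rfl⟩

variable {A : Set ℕ}

theorem edges_le (F : T.Flags) (A : Set ℕ) : F.edges A ≤ G := by
  rintro x y ⟨n, -, ⟨rfl, rfl⟩ | ⟨rfl, rfl⟩⟩
  exacts [F.adj n, (F.adj n).symm]

theorem col_le (F : T.Flags) (A : Set ℕ) : F.col A ≤ G := fun _ _ h =>
  h.elim (fun h => graph_le h.1) fun h => F.edges_le A h.1

theorem edges_adj_mem (h : (F.edges A).Adj x y) : ∃ n ∈ A, x ∈ F.seg n ∧ y ∈ F.seg n := by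
  obtain ⟨n, hn, ⟨rfl, rfl⟩ | ⟨rfl, rfl⟩⟩ := h
  exacts [⟨n, hn, F.p_mem n, F.s_mem n⟩, ⟨n, hn, F.s_mem n, F.p_mem n⟩]

theorem edges_adj_le (h : (F.edges A).Adj x y) (hle : T.Le x y) :
    ∃ n ∈ A, x = F.p n ∧ y = F.s n := by
  obtain ⟨n, hn, h | ⟨rfl, rfl⟩⟩ := h
  exacts [⟨n, hn, h⟩, absurd (hle.antisymm (F.le n)) (F.ne n).symm]

/-- A flag edge that enters `up v` comes from a flag that passes through `v`. -/
theorem edges_adj_enter (h : (F.edges A).Adj x y) (hx : ¬ T.Le v x) (hy : T.Le v y) :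
    ∃ n ∈ A, x = F.p n ∧ y = F.s n ∧ v ∈ F.seg n ∧ F.p n ≠ v := by
  obtain ⟨h1, h2⟩ := Le.le_or_of_adj ((F.edges_le A h).symm) hy hx
  obtain ⟨n, hn, rfl, rfl⟩ := edges_adj_le h (h1.trans hy)
  exact ⟨n, hn, rfl, rfl, ⟨h1, hy⟩, h2⟩

theorem edges_nbrs_finite (F : T.Flags) (A : Set ℕ) (x : V) : {y | (F.edges A).Adj x y}.Finite := by
  by_cases h : ∃ n, x ∈ F.seg n
  · obtain ⟨n, hn⟩ := h
    refine (seg_finite (F := F) (n := n)).subset fun y hy => ?_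
    obtain ⟨m, -, h1, h2⟩ := edges_adj_mem hy
    rwa [← eq_of_mem h1 hn]
  · refine Set.finite_empty.subset fun y hy => ?_
    obtain ⟨m, -, h1, h2⟩ := edges_adj_mem hy
    exact h ⟨m, h1⟩

end Flags
end NormalTree

/-- The edge `xy` is the only edge of the relation `K` leaving some set that contains `x` but not
`y`. -/
def IsCut (K : V → V → Prop) (x y : V) : Prop :=
  ∃ S : Set V, x ∈ S ∧ y ∉ S ∧ ∀ a ∈ S, ∀ b ∉ S, K a b → a = x ∧ b = y

theorem IsCut.symm {K : V → V → Prop} (hK : ∀ a b, K a b → K b a) {x y : V} (h : IsCut K x y) :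
    IsCut K y x := by
  obtain ⟨S, hx, hy, h⟩ := h
  exact ⟨Sᶜ, hy, fun h' => h' hx, fun a ha b hb hab =>
    (h b (Set.notMem_compl_iff.1 hb) a ha (hK _ _ hab)).symm⟩

theorem IsCut.comap {W : Type*} {K : V → V → Prop} {L : W → W → Prop} {f : V → W}
    (hf : Function.Injective f) (hKL : ∀ a b, K a b → L (f a) (f b)) {x y : V}
    (h : IsCut L (f x) (f y)) : IsCut K x y := by
  obtain ⟨S, hx, hy, h⟩ := h
  exact ⟨f ⁻¹' S, hx, hy, fun a ha b hb hab =>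
    (h _ ha _ hb (hKL _ _ hab)).imp (fun h => hf h) fun h => hf h⟩

/-- Finitely many edges at `x` are outside the colour class `C`. -/
def FinZero (G C : SimpleGraph V) (x : V) : Prop := {y | G.Adj x y ∧ ¬ C.Adj x y}.Finite

/-- The edges in the colour class `C`, and those joining two vertices satisfying `FinZero`. -/
def preCore (G C : SimpleGraph V) (x y : V) : Prop :=
  G.Adj x y ∧ (C.Adj x y ∨ (FinZero G C x ∧ FinZero G C y))

/-- The colour class `C` together with the bridges of `preCore G C`. -/
def core (G C : SimpleGraph V) (x y : V) : Prop :=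
  C.Adj x y ∨ (preCore G C x y ∧ IsCut (preCore G C) x y)

theorem preCore.symm {C : SimpleGraph V} {x y : V} (h : preCore G C x y) : preCore G C y x :=
  ⟨h.1.symm, h.2.imp (fun h => h.symm) And.symm⟩

theorem core.symm {C : SimpleGraph V} {x y : V} (h : core G C x y) : core G C y x :=
  h.imp (fun h => h.symm) fun h => ⟨h.1.symm, h.2.symm fun _ _ h => h.symm⟩

/-- The edges of the core that are not in `C` or not bridges. -/
def loops (G C : SimpleGraph V) (x y : V) : Prop :=
  core G C x y ∧ (C.Adj x y → ¬ IsCut (core G C) x y)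

section Transport

variable {C C' : SimpleGraph V} (γ : G ≃g G)

theorem symm_transport (h : ∀ x y, C'.Adj (γ x) (γ y) ↔ C.Adj x y) (x y : V) :
    C.Adj (γ.symm x) (γ.symm y) ↔ C'.Adj x y := by
  rw [← h, RelIso.apply_symm_apply, RelIso.apply_symm_apply]

theorem FinZero.map (h : ∀ x y, C'.Adj (γ x) (γ y) ↔ C.Adj x y) {x : V} (hx : FinZero G C x) :
    FinZero G C' (γ x) := by
  refine (hx.image γ).subset fun y hy => ⟨γ.symm y, ?_, RelIso.apply_symm_apply _ _⟩
  refine ⟨?_, ?_⟩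
  · rw [← γ.map_adj_iff, RelIso.apply_symm_apply]; exact hy.1
  · rw [← h, RelIso.apply_symm_apply]; exact hy.2

theorem preCore.map (h : ∀ x y, C'.Adj (γ x) (γ y) ↔ C.Adj x y) {x y : V}
    (hx : preCore G C x y) : preCore G C' (γ x) (γ y) :=
  ⟨γ.map_adj_iff.2 hx.1, hx.2.imp (h _ _).2 fun h' => ⟨h'.1.map γ h, h'.2.map γ h⟩⟩

theorem core.map (h : ∀ x y, C'.Adj (γ x) (γ y) ↔ C.Adj x y) {x y : V}
    (hx : core G C x y) : core G C' (γ x) (γ y) := by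
  refine hx.imp (h _ _).2 fun h' => ⟨h'.1.map γ h, ?_⟩
  refine IsCut.comap γ.symm.injective (L := preCore G C)
    (fun a b hab => hab.map γ.symm (symm_transport γ h)) ?_
  rw [RelIso.symm_apply_apply, RelIso.symm_apply_apply]
  exact h'.2

theorem loops.map (h : ∀ x y, C'.Adj (γ x) (γ y) ↔ C.Adj x y) {x y : V}
    (hx : loops G C x y) : loops G C' (γ x) (γ y) :=
  ⟨hx.1.map γ h, fun h1 h2 => hx.2 ((h _ _).1 h1)
    (h2.comap γ.injective fun _ _ hab => hab.map γ h)⟩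

end Transport

end EdgeColouring

/-! ### Recovering the tree and the flag segments from a colouring -/

namespace EdgeColouring
variable {V : Type*} {G : SimpleGraph V}

namespace NormalTree
namespace Flags

variable {T : NormalTree G} {F : T.Flags} {A B : Set ℕ} {m n : ℕ} {v x y z : V}

/-- The tree together with the flags that have index in `A`. -/
def span (F : T.Flags) (A : Set ℕ) : SimpleGraph V := T.graph ⊔ F.edges A

theorem span_adj : (F.span A).Adj x y ↔ T.graph.Adj x y ∨ (F.edges A).Adj x y := Iff.rfl

/-- Toggling flags changes only finitely many edges at each vertex. -/
theorem finZero_col_iff : FinZero G (F.col A) x ↔ (T.coNbrs x).Finite := by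
  constructor
  · intro h
    refine (h.union (F.edges_nbrs_finite A x)).subset fun y hy => ?_
    by_cases he : (F.edges A).Adj x y
    · exact Or.inr he
    · exact Or.inl ⟨hy.1, fun hc => hc.elim (fun h => hy.2 h.1) fun h => he h.1⟩
  · intro h
    refine (h.union (F.edges_nbrs_finite A x)).subset fun y hy => ?_
    by_cases he : (F.edges A).Adj x y
    · exact Or.inr he
    · exact Or.inl ⟨hy.1, fun ht => hy.2 (Or.inl ⟨ht, he⟩)⟩

theorem par_s_of_adj (ht : T.graph.Adj (F.p n) (F.s n)) : T.par (F.s n) = F.p n :=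
  ((F.le n).graph_adj ht).2

theorem mem_seg_iff_of_par_s (h : T.par (F.s n) = F.p n) :
    z ∈ F.seg n ↔ z = F.p n ∨ z = F.s n := by
  constructor
  · intro hz
    by_cases hne : z = F.s n
    · exact Or.inr hne
    · exact Or.inl ((h ▸ hz.2.le_par hne).antisymm hz.1)
  · rintro (rfl | rfl)
    exacts [F.p_mem n, F.s_mem n]

theorem preCore_of_graph_adj (h : T.graph.Adj x y) : preCore G (F.col A) x y := by
  refine ⟨graph_le h, ?_⟩
  by_cases he : (F.edges A).Adj x y
  · right
    rw [finZero_col_iff, finZero_col_iff]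
    obtain ⟨n, -, ⟨rfl, rfl⟩ | ⟨rfl, rfl⟩⟩ := he
    · exact ⟨F.finite_p n (par_s_of_adj h), F.finite_s n (par_s_of_adj h)⟩
    · exact ⟨F.finite_s n (par_s_of_adj h.symm), F.finite_p n (par_s_of_adj h.symm)⟩
  · exact Or.inl (Or.inl ⟨h, he⟩)

/-- Any other edge of `G` entering the branch at `s n` starts at a vertex with infinitely many
non-tree edges, by `F.cross`. Such an edge is in `preCore` only if it is in the colour class, and no
tree or flag edge other than this one enters the branch. -/
theorem isCut_preCore (h : T.par (F.s n) = F.p n) :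
    IsCut (preCore G (F.col A)) (F.p n) (F.s n) := by
  refine ⟨(T.up (F.s n))ᶜ, fun h' => F.ne n ((F.le n).antisymm h'),
    fun h' => h' (le_refl _), fun a ha b hb hab => ?_⟩
  have hb : T.Le (F.s n) b := Set.notMem_compl_iff.1 hb
  obtain ⟨h1, h2⟩ := Le.le_or_of_adj hab.1.symm hb ha
  by_contra hne
  have hinf := F.cross n h a b hab.1 h1 h2 hb (by rw [not_and_or] at hne; exact hne.symm)
  rcases hab.2 with hc | ⟨hc, -⟩
  · rcases hc with ⟨hc, -⟩ | ⟨hc, -⟩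
    · obtain ⟨h3, h4, -⟩ := graph_adj_enter hc ha hb
      exact hne ⟨h4.symm.trans h, h3⟩
    · obtain ⟨m, -, rfl, rfl, h3, -⟩ := edges_adj_enter hc ha hb
      have := eq_of_mem h3 (F.s_mem n)
      exact hne ⟨by rw [this], by rw [this]⟩
  · exact hinf (finZero_col_iff.1 hc)

/-- The only edges of the union missing from the colour class are flags that are tree edges, and
these are bridges of `preCore`. Conversely `preCore` contains the spanning tree, so each of its
bridges is a tree edge. -/
theorem core_iff : core G (F.col A) x y ↔ (F.span A).Adj x y := by
  rw [span_adj]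
  constructor
  · rintro (h | ⟨h, S, hx, hy, hS⟩)
    · exact h.imp And.left And.left
    · left
      rcases comparable_of_adj (T := T) h.1 with hle | hle
      · obtain ⟨z, h1, h2, h3, -⟩ := hle.exists_crossing hx hy
        obtain ⟨rfl, rfl⟩ := hS _ h2 _ h3 (preCore_of_graph_adj (graph_adj_par h1))
        exact graph_adj_par h1
      · obtain ⟨z, h1, h2, h3, -⟩ := hle.exists_crossing (S := Sᶜ) hy fun h' => h' hx
        obtain ⟨rfl, rfl⟩ := hS _ (Set.notMem_compl_iff.1 h3) _ h2
          (preCore_of_graph_adj (graph_adj_par h1)).symm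
        exact (graph_adj_par h1).symm
  · intro h
    by_cases hc : (F.col A).Adj x y
    · exact Or.inl hc
    · have hte : T.graph.Adj x y ∧ (F.edges A).Adj x y := by
        rcases h with h | h
        · exact ⟨h, by_contra fun he => hc (Or.inl ⟨h, he⟩)⟩
        · exact ⟨by_contra fun ht => hc (Or.inr ⟨h, ht⟩), h⟩
      refine Or.inr ⟨preCore_of_graph_adj hte.1, ?_⟩
      obtain ⟨ht, n, hn, ⟨rfl, rfl⟩ | ⟨rfl, rfl⟩⟩ := hte
      · exact isCut_preCore (par_s_of_adj ht)
      · exact (isCut_preCore (par_s_of_adj ht.symm)).symm fun _ _ h => h.symm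

theorem isCut_of_par (hv : v ≠ T.root) (h : ∀ n ∈ A, ¬ (T.par v ∈ F.seg n ∧ v ∈ F.seg n)) :
    IsCut (core G (F.col A)) (T.par v) v := by
  refine ⟨(T.up v)ᶜ, not_le_par hv, fun h' => h' (le_refl v), fun a ha b hb hab => ?_⟩
  have hb : T.Le v b := Set.notMem_compl_iff.1 hb
  rcases core_iff.1 hab with ht | he
  · obtain ⟨h1, h2, -⟩ := graph_adj_enter ht ha hb
    exact ⟨h2.symm, h1⟩
  · obtain ⟨n, hn, rfl, rfl, h1, h2⟩ := edges_adj_enter he ha hb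
    exact absurd ⟨⟨h1.1.le_par h2, (par_le v).trans h1.2⟩, h1⟩ (h n hn)

/-- The tree path from `p n` to `s n` and the flag form a cycle through this edge. -/
theorem not_isCut_of_par (hv : v ≠ T.root) (hn : n ∈ A) (hns : T.par (F.s n) ≠ F.p n)
    (h : T.par v ∈ F.seg n) (h' : v ∈ F.seg n) : ¬ IsCut (core G (F.col A)) (T.par v) v := by
  rintro ⟨S, hx, hy, hS⟩
  have key : ∀ z, z ≠ T.root → z ∈ S → T.par z ∉ S → False := by
    intro z hz hzS hpS
    obtain ⟨h1, h2⟩ := hS _ hzS _ hpS (core_iff.2 (Or.inl (graph_adj_par hz).symm))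
    have h3 := T.lev_par z hz
    have h4 := T.lev_par v hv
    rw [h2, h1] at h3
    lia
  have hp : F.p n ∈ S := by
    by_contra hp
    obtain ⟨z, h1, h2, h3, -⟩ := h.1.exists_crossing (S := Sᶜ) hp fun h' => h' hx
    exact key z h1 (Set.notMem_compl_iff.1 h3) h2
  have hs : F.s n ∉ S := by
    intro hs
    obtain ⟨z, h1, h2, h3, -⟩ := h'.2.exists_crossing (S := Sᶜ) hy fun h' => h' hs
    exact key z h1 (Set.notMem_compl_iff.1 h3) h2
  obtain ⟨h1, h2⟩ := hS _ hp _ hs (core_iff.2 (Or.inr ⟨n, hn, Or.inl ⟨rfl, rfl⟩⟩))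
  exact hns (by rw [h2, h1])

theorem not_isCut_flag (hns : T.par (F.s n) ≠ F.p n) :
    ¬ IsCut (core G (F.col A)) (F.p n) (F.s n) := by
  rintro ⟨S, hx, hy, hS⟩
  obtain ⟨z, h1, h2, h3, -⟩ := (F.le n).exists_crossing hx hy
  obtain ⟨h4, h5⟩ := hS _ h2 _ h3 (core_iff.2 (Or.inl (graph_adj_par h1)))
  exact hns (h5 ▸ h4)

/-- A non-tree flag closes a cycle with its segment, whose edges are then not bridges; a tree-edge
flag is missing from the colour class. All other edges of the union are bridges in the colour class.
So `loops` marks exactly the active segments. -/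
theorem loops_iff : loops G (F.col A) x y ↔
    (F.span A).Adj x y ∧ ∃ n ∈ A, x ∈ F.seg n ∧ y ∈ F.seg n := by
  unfold loops
  rw [core_iff]
  refine and_congr_right fun hxy => ?_
  constructor
  · intro h
    by_cases he : (F.edges A).Adj x y
    · exact edges_adj_mem he
    have ht := (span_adj.1 hxy).resolve_right he
    have hcut := h (Or.inl ⟨ht, he⟩)
    by_contra hno
    push Not at hno
    rcases ht with ⟨hr, rfl⟩ | ⟨hr, rfl⟩
    · exact hcut (isCut_of_par hr fun n hn h => hno n hn h.1 h.2)
    · exact hcut ((isCut_of_par hr fun n hn h => hno n hn h.2 h.1).symm fun _ _ h => h.symm)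
  · rintro ⟨n, hn, hx, hy⟩ hc
    have hns : T.par (F.s n) ≠ F.p n := by
      intro hp
      have h1 : T.graph.Adj (F.p n) (F.s n) :=
        Or.inl ⟨(F.le n).ne_root (F.ne n), hp⟩
      have h2 : (F.edges A).Adj (F.p n) (F.s n) := ⟨n, hn, Or.inl ⟨rfl, rfl⟩⟩
      rw [mem_seg_iff_of_par_s hp] at hx hy
      have hxy' := hxy.ne
      rcases hx with rfl | rfl <;> rcases hy with rfl | rfl
      · exact hxy' rfl
      · exact hc.elim (fun h => h.2 h2) fun h => h.2 h1
      · exact hc.elim (fun h => h.2 h2.symm) fun h => h.2 h1.symm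
      · exact hxy' rfl
    rcases hxy with (⟨hr, rfl⟩ | ⟨hr, rfl⟩) | ⟨m, hm, ⟨rfl, rfl⟩ | ⟨rfl, rfl⟩⟩
    · exact not_isCut_of_par hr hn hns hx hy
    · exact fun h => not_isCut_of_par hr hn hns hy hx (h.symm fun _ _ h => h.symm)
    · obtain rfl := eq_of_mem hx (F.p_mem m)
      exact not_isCut_flag hns
    · obtain rfl := eq_of_mem hy (F.p_mem m)
      exact fun h => not_isCut_flag hns (h.symm fun _ _ h => h.symm)

section Transport

variable (γ : G ≃g G)

theorem span_adj_map_iff (h : ∀ x y, (F.col B).Adj (γ x) (γ y) ↔ (F.col A).Adj x y) (x y : V) :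
    (F.span B).Adj (γ x) (γ y) ↔ (F.span A).Adj x y := by
  rw [← core_iff, ← core_iff]
  refine ⟨fun h' => ?_, fun h' => h'.map γ h⟩
  have := h'.map γ.symm (symm_transport γ h)
  rwa [RelIso.symm_apply_apply, RelIso.symm_apply_apply] at this

/-- Consecutive vertices of a segment go to a common segment, and disjointness of segments carries
this along the whole segment. -/
theorem exists_map_seg (h : ∀ x y, (F.col B).Adj (γ x) (γ y) ↔ (F.col A).Adj x y) (hn : n ∈ A) :
    ∃ m ∈ B, ∀ z ∈ F.seg n, γ z ∈ F.seg m := by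
  have key : ∀ z, z ∈ F.seg n → z ≠ F.p n → T.par z ∈ F.seg n ∧
      ∃ m ∈ B, γ (T.par z) ∈ F.seg m ∧ γ z ∈ F.seg m := by
    intro z hz hne
    have hr := hz.1.ne_root hne.symm
    have hp : T.par z ∈ F.seg n := ⟨hz.1.le_par hne.symm, (par_le z).trans hz.2⟩
    have : loops G (F.col A) (T.par z) z :=
      loops_iff.2 ⟨Or.inl (graph_adj_par hr), n, hn, hp, hz⟩
    exact ⟨hp, (loops_iff.1 (this.map γ h)).2⟩
  obtain ⟨c, hc1, hc2, hc3⟩ := (F.le n).exists_child (F.ne n)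
  have hcn : c ∈ F.seg n := ⟨hc2 ▸ par_le c, hc3⟩
  obtain ⟨-, m, hm, h1, -⟩ := key c hcn fun h' => par_ne hc1 (hc2.trans h'.symm)
  rw [hc2] at h1
  refine ⟨m, hm, ?_⟩
  have hind : ∀ k z, z ∈ F.seg n → T.par^[k] z = F.p n → γ z ∈ F.seg m := by
    intro k
    induction k with
    | zero => intro z _ hk; rwa [show z = F.p n from hk]
    | succ k ih =>
      intro z hz hk
      by_cases hne : z = F.p n
      · rwa [hne]
      · obtain ⟨h2, m', -, h3, h4⟩ := key z hz hne
        have h5 := ih _ h2 hk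
        rwa [eq_of_mem h5 h3]
  exact fun z hz => hz.1.elim fun k hk => hind k z hz hk

theorem exists_map_seg_iff (h : ∀ x y, (F.col B).Adj (γ x) (γ y) ↔ (F.col A).Adj x y)
    (hn : n ∈ A) : ∃ m ∈ B, ∀ z, γ z ∈ F.seg m ↔ z ∈ F.seg n := by
  obtain ⟨m, hm, h1⟩ := exists_map_seg γ h hn
  obtain ⟨n', -, h2⟩ := exists_map_seg γ.symm (symm_transport γ h) hm
  have h3 := h2 _ (h1 _ (F.p_mem n))
  rw [RelIso.symm_apply_apply] at h3
  obtain rfl := eq_of_mem h3 (F.p_mem n)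
  refine ⟨m, hm, fun z => ⟨fun hz => ?_, h1 z⟩⟩
  have := h2 _ hz
  rwa [RelIso.symm_apply_apply] at this

end Transport

end Flags
end NormalTree
end EdgeColouring

/-! ### Rigidity of the segments via distances -/

namespace EdgeColouring
variable {V : Type*} {G : SimpleGraph V}

theorem dist_le_of_map {V' : Type*} {H : SimpleGraph V} {H' : SimpleGraph V'} (hc : H.Connected)
    (f : H →g H') (x y : V) : H'.dist (f x) (f y) ≤ H.dist x y := by
  obtain ⟨p, hp⟩ := hc.exists_walk_length_eq_dist x y
  rw [← hp, ← SimpleGraph.Walk.length_map f p]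
  exact SimpleGraph.dist_le _

/-- If every edge that enters `S` ends at `v`, then distances into `S` are measured through `v`. -/
theorem dist_eq_of_enter {H : SimpleGraph V} (hc : H.Connected) {S : Set V} {v : V} (hv : v ∈ S)
    (h : ∀ a b, H.Adj a b → a ∉ S → b ∈ S → b = v) {x y : V} (hx : x ∉ S) (hy : y ∈ S) :
    H.dist x y = H.dist x v + H.dist v y := by
  refine le_antisymm hc.dist_triangle ?_
  obtain ⟨p, hp⟩ := hc.exists_walk_length_eq_dist x y
  rw [← hp]
  clear hp
  induction p with
  | nil => exact absurd hy hx
  | @cons x b y hxb q ih =>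
    have h1 : H.dist x b = 1 := SimpleGraph.dist_eq_one_iff_adj.2 hxb
    rw [SimpleGraph.Walk.length_cons]
    by_cases hb : b ∈ S
    · have h2 := SimpleGraph.dist_le q
      obtain rfl := h x b hxb hx hb
      lia
    · have h2 := ih hb hy
      have h3 := hc.dist_triangle (u := x) (v := b) (w := v)
      lia

namespace NormalTree
namespace Flags

variable {T : NormalTree G} {F : T.Flags} {A B : Set ℕ} {m n k : ℕ} {a g h v x y z : V}

theorem exists_walk_root (F : T.Flags) (A : Set ℕ) (v : V) :
    ∃ p : (F.span A).Walk T.root v, p.length = T.lev v := by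
  induction hk : T.lev v generalizing v with
  | zero =>
    obtain rfl := eq_root_of_lev hk
    exact ⟨.nil, rfl⟩
  | succ k ih =>
    have hv : v ≠ T.root := by rintro rfl; rw [T.lev_root] at hk; lia
    obtain ⟨p, hp⟩ := ih (T.par v) (by rw [lev_par', hk]; rfl)
    have hadj : (F.span A).Adj (T.par v) v := Or.inl (graph_adj_par hv)
    exact ⟨p.concat hadj, by rw [SimpleGraph.Walk.length_concat, hp]⟩

theorem span_connected (F : T.Flags) (A : Set ℕ) : (F.span A).Connected := by
  have h : ∀ v, (F.span A).Reachable T.root v := fun v => ⟨(F.exists_walk_root A v).choose⟩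
  have : Nonempty V := ⟨T.root⟩
  exact ⟨fun x y => (h x).symm.trans (h y)⟩

theorem dist_root_le (F : T.Flags) (A : Set ℕ) (v : V) : (F.span A).dist T.root v ≤ T.lev v := by
  obtain ⟨p, hp⟩ := F.exists_walk_root A v
  exact hp ▸ SimpleGraph.dist_le p

/-- A walk down to the root loses one level per step except when it jumps down a flag. A jump that
passes an ancestor of `F.p m` comes from an earlier flag, and then that ancestor has level at most
`M`. -/
theorem lev_p_le (F : T.Flags) (A : Set ℕ) {M : ℕ} (hM : ∀ i < m, T.lev (F.s i) ≤ M) :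
    T.lev (F.p m) ≤ M + (F.span A).dist T.root (F.p m) := by
  have key : ∀ {z r} (q : (F.span A).Walk z r), r = T.root → ∀ a, T.Le a z → T.Le a (F.p m) →
      T.lev a ≤ M + q.length := by
    intro z r q hr
    induction q with
    | nil =>
      intro a ha _
      rw [hr] at ha
      have := ha.lev_le
      rw [T.lev_root] at this
      lia
    | @cons z b r hzb q ih =>
      intro a haz ham
      rw [SimpleGraph.Walk.length_cons]
      rcases hzb with (⟨hb, rfl⟩ | ⟨hz, rfl⟩) | ⟨i, hi, ⟨rfl, rfl⟩ | ⟨rfl, rfl⟩⟩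
      · have := ih hr a (haz.trans (par_le b)) ham
        lia
      · by_cases hne : a = z
        · subst hne
          have := ih hr _ (le_refl _) ((par_le a).trans ham)
          have := T.lev_par a hz
          lia
        · have := ih hr a (haz.le_par hne) ham
          lia
      · have := ih hr a (haz.trans (F.le i)) ham
        lia
      · have hai : i < m ∨ T.Le a (F.p i) := by
          rcases lt_trichotomy i m with hlt | rfl | hlt
          · exact Or.inl hlt
          · exact Or.inr ham
          · refine Or.inr ((haz.total (F.le i)).resolve_right fun h => ?_)
            exact F.not_le m i hlt ((h.trans ham).trans (F.le m))
        rcases hai with hi | hi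
        · have := haz.lev_le
          have := hM i hi
          lia
        · have := ih hr a hi ham
          lia
  obtain ⟨q, hq⟩ := (F.span_connected A).exists_walk_length_eq_dist (F.p m) T.root
  rw [SimpleGraph.dist_comm, ← hq]
  exact key q rfl _ (le_refl _) (le_refl _)

theorem seg_ncard (F : T.Flags) (n : ℕ) :
    (F.seg n).ncard = T.lev (F.s n) + 1 - T.lev (F.p n) := by
  have hinj : Set.InjOn T.lev (F.seg n) := fun x hx y hy hxy =>
    (hx.2.of_lev_le hy.2 hxy.le).eq_of_lev hxy.ge
  have himg : T.lev '' F.seg n = ↑(Finset.Icc (T.lev (F.p n)) (T.lev (F.s n))) := by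
    ext ℓ
    rw [Finset.coe_Icc, Set.mem_Icc]
    constructor
    · rintro ⟨z, hz, rfl⟩
      exact ⟨hz.1.lev_le, hz.2.lev_le⟩
    · rintro ⟨h1, h2⟩
      have h3 := lev_iterate (T := T) (T.lev (F.s n) - ℓ) (F.s n)
      rw [Nat.sub_sub_self h2] at h3
      have h4 : T.Le (T.par^[T.lev (F.s n) - ℓ] (F.s n)) (F.s n) := ⟨_, rfl⟩
      exact ⟨_, ⟨(F.le n).of_lev_le h4 (by rw [h3]; exact h1), h4⟩, h3⟩
  rw [← hinj.ncard_image, himg, Set.ncard_coe_finset, Nat.card_Icc]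

section Rigidity

variable (γ : G ≃g G)

theorem dist_map (hγ : ∀ x y, (F.col B).Adj (γ x) (γ y) ↔ (F.col A).Adj x y) (x y : V) :
    (F.span B).dist (γ x) (γ y) = (F.span A).dist x y := by
  let f : F.span A →g F.span B := ⟨γ, fun h => (span_adj_map_iff γ hγ _ _).2 h⟩
  let f' : F.span B →g F.span A :=
    ⟨γ.symm, fun h => (span_adj_map_iff γ.symm (symm_transport γ hγ) _ _).2 h⟩
  refine le_antisymm (dist_le_of_map (F.span_connected A) f x y) ?_
  have h := dist_le_of_map (F.span_connected B) f' (γ x) (γ y)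
  change (F.span A).dist (γ.symm (γ x)) (γ.symm (γ y)) ≤ _ at h
  rwa [RelIso.symm_apply_apply, RelIso.symm_apply_apply] at h

theorem ncard_seg_eq (hmn : ∀ z, γ z ∈ F.seg m ↔ z ∈ F.seg n) :
    (F.seg n).ncard = (F.seg m).ncard := by
  rw [← Set.ncard_image_of_injective (F.seg n) γ.injective]
  congr 1
  ext z
  constructor
  · rintro ⟨y, hy, rfl⟩
    exact (hmn y).2 hy
  · intro hz
    exact ⟨γ.symm z, (hmn _).1 (by rwa [RelIso.apply_symm_apply]), RelIso.apply_symm_apply _ _⟩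

/-- With `M = T.lev (F.s m)`, the segment `n` has at most `M + 1` vertices, while `F.p (m + 1)` has
level at most `2 * M + (m + 1)`: one `M` from `lev_p_le`, one from the level of its preimage in
segment `n`, and `m + 1` from the displacement of the root. Equal lengths would contradict `3 * M +
(m + 1) < T.lev (F.s (m + 1))`. -/
theorem not_lt_of_map_seg (hγ : ∀ x y, (F.col B).Adj (γ x) (γ y) ↔ (F.col A).Adj x y)
    (hmn : ∀ z, γ z ∈ F.seg m ↔ z ∈ F.seg n) (hm : (F.span B).dist T.root (γ T.root) ≤ m) :
    ¬ n < m := by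
  intro hlt
  obtain ⟨m, rfl⟩ := Nat.exists_eq_succ_of_ne_zero (Nat.ne_zero_of_lt hlt)
  have hM : ∀ i < m + 1, T.lev (F.s i) ≤ T.lev (F.s m) := by
    intro i hi
    rcases (Nat.lt_succ_iff.1 hi).lt_or_eq with h | rfl
    · have := F.lev_lt i m h
      lia
    · exact le_rfl
  have hcard := ncard_seg_eq γ hmn
  rw [seg_ncard, seg_ncard] at hcard
  have h1 := F.lev_p_le B hM
  have h2 := F.lev_lt m (m + 1) (Nat.lt_succ_self m)
  have h3 := hM n hlt
  have h4 : γ.symm (F.p (m + 1)) ∈ F.seg n := by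
    rw [← hmn, RelIso.apply_symm_apply]; exact F.p_mem _
  have h5 := h4.2.lev_le
  have h6 := F.dist_root_le A (γ.symm (F.p (m + 1)))
  rw [← dist_map γ hγ, RelIso.apply_symm_apply] at h6
  have h7 := (F.span_connected B).dist_triangle (u := T.root) (v := γ T.root) (w := F.p (m + 1))
  have h8 := (F.le n).lev_le
  have h9 := (F.le (m + 1)).lev_le
  simp only [Nat.succ_eq_add_one] at hcard hm
  lia

theorem mem_of_dist_le (hγ : ∀ x y, (F.col B).Adj (γ x) (γ y) ↔ (F.col A).Adj x y) (hn : n ∈ A)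
    (hD : (F.span B).dist T.root (γ T.root) ≤ n) :
    n ∈ B ∧ ∀ z, γ z ∈ F.seg n ↔ z ∈ F.seg n := by
  obtain ⟨m, hm, hmn⟩ := exists_map_seg_iff γ hγ hn
  have hnm : m = n := by
    rcases lt_trichotomy m n with hlt | heq | hlt
    · refine absurd hlt (not_lt_of_map_seg γ.symm (symm_transport γ hγ) (fun z => ?_) ?_)
      · rw [← hmn, RelIso.apply_symm_apply]
      · rwa [← dist_map γ hγ, RelIso.apply_symm_apply, SimpleGraph.dist_comm]
    · exact heq
    · exact absurd hlt (not_lt_of_map_seg γ hγ hmn (hD.trans hlt.le))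
  subst hnm
  exact ⟨hm, hmn⟩

theorem mem_iff_of_dist_le (hγ : ∀ x y, (F.col B).Adj (γ x) (γ y) ↔ (F.col A).Adj x y)
    (hD : (F.span B).dist T.root (γ T.root) ≤ n) : n ∈ A ↔ n ∈ B := by
  refine ⟨fun hn => (mem_of_dist_le γ hγ hn hD).1, fun hn => ?_⟩
  refine (mem_of_dist_le γ.symm (symm_transport γ hγ) hn ?_).1
  rwa [← dist_map γ hγ, RelIso.apply_symm_apply, SimpleGraph.dist_comm]

/-- If no flag passes strictly through `v`, then the branch at `v` is entered only at `v`. -/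
theorem enter_up (hv : ∀ k ∈ A, ¬ (v ∈ F.seg k ∧ v ≠ F.p k ∧ v ≠ F.s k)) (a b : V)
    (hab : (F.span A).Adj a b) (ha : a ∉ T.up v) (hb : b ∈ T.up v) : b = v := by
  rcases hab with h | h
  · exact (graph_adj_enter h ha hb).1
  · obtain ⟨k, hk, rfl, rfl, h1, h2⟩ := edges_adj_enter h ha hb
    by_contra h3
    exact hv k hk ⟨h1, h2.symm, fun h => h3 h.symm⟩

variable {γ}

/-- Both the root and its image reach the segment through `F.p n`, so comparing distances before and
after `γ` forces the distance from `F.p n` to its image to vanish. -/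
theorem apply_p_eq (hγ : ∀ x y, (F.col A).Adj (γ x) (γ y) ↔ (F.col A).Adj x y)
    (hseg : ∀ z, γ z ∈ F.seg n ↔ z ∈ F.seg n) (hr : ¬ T.Le (F.p n) (γ T.root)) :
    γ (F.p n) = F.p n := by
  have hc := F.span_connected A
  have hroot : T.root ∉ T.up (F.p n) := fun h => F.p_ne_root n (h.antisymm (root_le _))
  have henter := enter_up (F := F) (A := A) (v := F.p n) fun k _ h =>
    h.2.1 (by rw [eq_of_mem h.1 (F.p_mem n)])
  have h0 : γ.symm (F.p n) ∈ F.seg n := by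
    rw [← hseg, RelIso.apply_symm_apply]; exact F.p_mem n
  have h1 := dist_eq_of_enter hc (le_refl (F.p n)) henter hroot h0.1
  have h2 := dist_eq_of_enter hc (le_refl (F.p n)) henter hr ((hseg _).2 (F.p_mem n)).1
  rw [dist_map γ hγ] at h2
  rw [← dist_map γ hγ T.root, RelIso.apply_symm_apply] at h1
  have h3 : (F.span A).dist (F.p n) (γ (F.p n)) = 0 := by lia
  exact (hc.dist_eq_zero_iff.1 h3).symm

/-- From outside `S` the fixed point `x` is reached through `v`, so the image of `v` would be
farther from `x` than `v` is. -/
theorem apply_eq_of_enter (hγ : ∀ x y, (F.col A).Adj (γ x) (γ y) ↔ (F.col A).Adj x y)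
    {S : Set V} (hv : v ∈ S) (hS : ∀ a b, (F.span A).Adj a b → a ∉ S → b ∈ S → b = v)
    (hvS : γ v ∉ S) (hx : x ∈ S) (hγx : γ x = x) : False := by
  have hc := F.span_connected A
  have h1 := dist_eq_of_enter hc hv hS hvS hx
  have h2 := dist_map γ hγ v x
  rw [hγx] at h2
  have h3 := hc.dist_eq_zero_iff.1 (show (F.span A).dist (γ v) v = 0 by lia)
  exact hvS (by rw [h3]; exact hv)

/-- A vertex through which no flag passes strictly is fixed if there are fixed vertices below
and above it. -/
theorem apply_eq_of_fixed (hγ : ∀ x y, (F.col A).Adj (γ x) (γ y) ↔ (F.col A).Adj x y)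
    (hv : ∀ k ∈ A, ¬ (v ∈ F.seg k ∧ v ≠ F.p k ∧ v ≠ F.s k)) (ha : γ a = a) (hav : ¬ T.Le v a)
    (hx : γ x = x) (hvx : T.Le v x) : γ v = v := by
  have hc := F.span_connected A
  by_cases hvS : γ v ∈ T.up v
  · have h1 := dist_eq_of_enter hc (le_refl v) (enter_up hv) hav hvS
    have h2 := dist_map γ hγ a v
    rw [ha] at h2
    exact (hc.dist_eq_zero_iff.1 (show (F.span A).dist v (γ v) = 0 by lia)).symm
  · exact (apply_eq_of_enter hγ (le_refl v) (enter_up hv) hvS hvx hx).elim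

/-- The last vertex of an invariant segment with infinitely many vertices above it is fixed. -/
theorem apply_eq_of_last (hγ : ∀ x y, (F.col A).Adj (γ x) (γ y) ↔ (F.col A).Adj x y)
    (hseg : ∀ z, γ z ∈ F.seg k ↔ z ∈ F.seg k) (hg : g ∈ F.seg k) (hgp : g ≠ F.p k)
    (hgh : T.par g = h) (hhp : h ≠ F.p k) (hx : γ x = x) (hhx : T.Le h x) (hgx : ¬ T.Le g x) :
    γ h = h := by
  subst hgh
  have hroot := hg.1.ne_root hgp.symm
  have hpg := hg.1.le_par hgp.symm
  have hhk : T.par g ∈ F.seg k := ⟨hpg, (par_le g).trans hg.2⟩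
  -- This region is entered only at `T.par g`, and it meets the segment only there.
  let S := T.up (T.par g) \ T.up g
  have hhS : T.par g ∈ S := ⟨le_refl _, not_le_par hroot⟩
  have hS : ∀ a b, (F.span A).Adj a b → a ∉ S → b ∈ S → b = T.par g := by
    rintro a b hab ha ⟨hb, hb'⟩
    by_cases hag : T.Le g a
    · rcases hab with hab | hab
      · have := graph_adj_enter hab.symm hb' hag
        exact this.2.1.symm
      · obtain ⟨i, hi, rfl, rfl, h1, h2⟩ := edges_adj_enter hab.symm hb' hag
        obtain rfl := eq_of_mem h1 hg
        exact absurd (hpg.antisymm hb) hhp.symm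
    · have hah : ¬ T.Le (T.par g) a := fun h => ha ⟨h, hag⟩
      rcases hab with hab | hab
      · exact (graph_adj_enter hab hah hb).1
      · obtain ⟨i, hi, rfl, rfl, h1, h2⟩ := edges_adj_enter hab hah hb
        obtain rfl := eq_of_mem h1 hhk
        exact absurd hg.2 hb'
  by_contra hne
  refine apply_eq_of_enter hγ hhS hS (fun hmem => hne ?_) (show x ∈ S from ⟨hhx, hgx⟩) hx
  have h1 : γ (T.par g) ∈ F.seg k := (hseg _).2 hhk
  have h2 : T.Le (γ (T.par g)) g := (h1.2.total hg.2).resolve_right hmem.2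
  have h3 : γ (T.par g) ≠ g := fun h =>
    hmem.2 (by change T.Le g _; rw [h]; exact le_refl g)
  exact (h2.le_par h3).antisymm hmem.1

end Rigidity

end Flags
end NormalTree
end EdgeColouring

/-! ### Automorphisms that preserve a colouring -/

namespace EdgeColouring
variable {V : Type*} {G : SimpleGraph V}

theorem finite_neighborSet_of_apply (γ : G ≃g G) {x : V} (h : (G.neighborSet (γ x)).Finite) :
    (G.neighborSet x).Finite := by
  refine Set.Finite.of_finite_image (f := γ) (h.subset ?_) γ.injective.injOn
  rintro _ ⟨y, hy, rfl⟩
  exact γ.map_adj_iff.2 hy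

namespace NormalTree

variable {T : NormalTree G}

theorem Le.induction_up {v : V} {Q : V → Prop} (h0 : Q v)
    (h : ∀ z, z ≠ T.root → T.Le v (T.par z) → Q (T.par z) → Q z) {z : V} (hz : T.Le v z) :
    Q z := by
  obtain ⟨k, hk⟩ := hz
  induction k generalizing z with
  | zero => rwa [show z = v from hk]
  | succ k ih =>
    rw [Function.iterate_succ_apply] at hk
    by_cases hr : z = T.root
    · subst hr
      rw [T.par_root] at hk
      exact ih hk
    · exact h z hr ⟨k, hk⟩ (ih hk)

theorem Le.induction_down {v z : V} {Q : V → Prop} (h0 : Q z)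
    (h : ∀ z, z ≠ T.root → T.Le v (T.par z) → Q z → Q (T.par z)) (hz : T.Le v z) : Q v := by
  obtain ⟨k, hk⟩ := hz
  induction k generalizing z with
  | zero => rwa [← show z = v from hk]
  | succ k ih =>
    rw [Function.iterate_succ_apply] at hk
    by_cases hr : z = T.root
    · subst hr
      rw [T.par_root] at hk
      exact ih h0 hk
    · exact ih (h z hr ⟨k, hk⟩ h0) hk

theorem Le.eq_of_par_eq {x y z : V} (hx : T.Le x z) (hy : T.Le y z) (hxr : x ≠ T.root)
    (hyr : y ≠ T.root) (h : T.par x = T.par y) : x = y := by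
  have h1 := T.lev_par x hxr
  have h2 := T.lev_par y hyr
  rw [h] at h1
  exact (hx.of_lev_le hy (by lia)).eq_of_lev (by lia)

namespace Flags

variable {F : T.Flags} {A : Set ℕ} {γ : G ≃g G} {P : Set V} {k n : ℕ} {v w x y z : V}

theorem eq_s_or_par_eq (hz : z ∈ F.seg k) (h : (F.span A).Adj (F.p k) z) :
    z = F.s k ∨ (z ≠ T.root ∧ T.par z = F.p k) := by
  rcases h with h | h
  · exact Or.inr (hz.1.graph_adj h)
  · obtain ⟨n, -, h1, rfl⟩ := edges_adj_le h hz.1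
    rw [F.p_injective h1]
    exact Or.inl rfl

/-- Induction up the segment: once two consecutive vertices are fixed, the next one has nowhere else
to go. -/
theorem apply_eq_of_mem_seg (hγ : ∀ x y, (F.col A).Adj (γ x) (γ y) ↔ (F.col A).Adj x y)
    (hseg : ∀ z, γ z ∈ F.seg k ↔ z ∈ F.seg k) (hp : γ (F.p k) = F.p k) (hwr : w ≠ T.root)
    (hwp : T.par w = F.p k) (hw : γ w = w) (hwz : T.Le w z) (hz : T.Le z (F.s k)) : γ z = z := by
  suffices h : T.Le z (F.s k) → γ z = z ∧ γ (T.par z) = T.par z from (h hz).1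
  refine hwz.induction_up (Q := fun z => T.Le z (F.s k) → γ z = z ∧ γ (T.par z) = T.par z)
    (fun _ => ⟨hw, by rw [hwp, hp]⟩) ?_
  intro z hzr hwz ih hzs
  obtain ⟨h1, h2⟩ := ih ((par_le z).trans hzs)
  refine ⟨?_, h1⟩
  have hpw : T.Le (F.p k) w := hwp ▸ par_le w
  have hzk : γ z ∈ F.seg k := (hseg z).2 ⟨hpw.trans (hwz.trans (par_le z)), hzs⟩
  have hadj : (F.span A).Adj (T.par z) (γ z) := by
    rw [← h1, span_adj_map_iff γ hγ]
    exact Or.inl (graph_adj_par hzr)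
  rcases hadj with (⟨h3, h4⟩ | ⟨h3, h4⟩) | h3
  · exact hzk.2.eq_of_par_eq hzs h3 hzr h4
  · rw [← h2] at h4
    have h5 := γ.injective h4
    have h6 := T.lev_par z hzr
    have h7 := T.lev_par _ h3
    rw [h5] at h7
    lia
  · obtain ⟨i, -, h⟩ := h3
    have hik : i = k := by
      rcases h with ⟨-, h⟩ | ⟨-, h⟩
      · exact eq_of_mem (h ▸ F.s_mem i) hzk
      · exact eq_of_mem (h ▸ F.p_mem i) hzk
    subst hik
    rcases h with ⟨h, -⟩ | ⟨h, -⟩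
    · rw [h, ← hwp] at hwz
      exact absurd hwz (not_le_par hwr)
    · rw [← h] at hzs
      exact absurd hzs (not_le_par hzr)

/-- The segment with its flag is a cycle on which `γ` fixes `F.p k`. If it moves a vertex, it must
exchange the two neighbours of `F.p k`. -/
theorem apply_eq_s (hγ : ∀ x y, (F.col A).Adj (γ x) (γ y) ↔ (F.col A).Adj x y) (hk : k ∈ A)
    (hseg : ∀ z, γ z ∈ F.seg k ↔ z ∈ F.seg k) (hp : γ (F.p k) = F.p k) (hwr : w ≠ T.root)
    (hwp : T.par w = F.p k) (hwz : T.Le w z) (hz : T.Le z (F.s k)) (hm : γ z ≠ z) :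
    γ w = F.s k ∧ γ (F.s k) = w := by
  have hpw : T.Le (F.p k) w := hwp ▸ par_le w
  have hws := hwz.trans hz
  have hww : γ w ≠ w := fun h => hm (apply_eq_of_mem_seg hγ hseg hp hwr hwp h hwz hz)
  have hwk : γ w ∈ F.seg k := (hseg w).2 ⟨hpw, hws⟩
  have hsk : γ (F.s k) ∈ F.seg k := (hseg _).2 (F.s_mem k)
  have h1 : (F.span A).Adj (F.p k) (γ w) := by
    rw [← hp, span_adj_map_iff γ hγ, ← hwp]
    exact Or.inl (graph_adj_par hwr)
  have h2 : (F.span A).Adj (F.p k) (γ (F.s k)) := by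
    rw [← hp, span_adj_map_iff γ hγ]
    exact Or.inr ⟨k, hk, Or.inl ⟨rfl, rfl⟩⟩
  have h3 : γ w = F.s k := (eq_s_or_par_eq hwk h1).resolve_right fun h =>
    hww (hwk.2.eq_of_par_eq hws h.1 hwr (h.2.trans hwp.symm))
  refine ⟨h3, ?_⟩
  rcases eq_s_or_par_eq hsk h2 with h | h
  · have h4 := γ.injective (h.trans h3.symm)
    exact absurd (by rw [← h4]; exact h) hww
  · exact hsk.2.eq_of_par_eq hws h.1 hwr (h.2.trans hwp.symm)

/-- `γ` respects the flags outside the finite set `P`. -/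
structure Controlled (F : T.Flags) (A : Set ℕ) (γ : G ≃g G) (P : Set V) : Prop where
  fin : P.Finite
  deg : ∀ v ∈ P, (G.neighborSet v).Finite
  col : ∀ x y, (F.col A).Adj (γ x) (γ y) ↔ (F.col A).Adj x y
  seg : ∀ n ∈ A, F.seg n ⊆ P ∨
    (F.s n ∉ P ∧ (∀ z, γ z ∈ F.seg n ↔ z ∈ F.seg n) ∧ γ (F.p n) = F.p n)
  fix : ∀ v, (T.up v).Infinite → v ∉ P →
    (∀ k ∈ A, ¬ (v ∈ F.seg k ∧ v ≠ F.p k ∧ v ≠ F.s k)) → γ v = v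
  freq : ∀ v, (T.up v).Infinite → {n ∈ A | T.Le v (F.p n)}.Infinite

theorem Controlled.exists_fixed (hc : F.Controlled A γ P) (hv : (T.up v).Infinite) {Y : Set V}
    (hY : Y.Finite) : ∃ n ∈ A, T.Le v (F.p n) ∧ F.p n ∉ Y ∧ γ (F.p n) = F.p n := by
  obtain ⟨_, ⟨n, hn, rfl⟩, h⟩ :=
    (((hc.freq v hv).image F.p_injective.injOn).sdiff (hY.union hc.fin)).nonempty
  rw [Set.mem_union, not_or] at h
  refine ⟨n, hn.1, hn.2, h.1, ?_⟩
  exact ((hc.seg n hn.1).resolve_left fun h' => h.2 (h' (F.p_mem n))).2.2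

/-- On a segment with a moved vertex `y` such that `up y` is infinite, `γ` acts as a reflection. -/
theorem Controlled.exists_reflection (hc : F.Controlled A γ P) (hy : (T.up y).Infinite)
    (hyP : y ∉ P) (hm : γ y ≠ y) : ∃ k ∈ A, ∃ w g, y ∈ F.seg k ∧
      (∀ z, γ z ∈ F.seg k ↔ z ∈ F.seg k) ∧ γ (F.p k) = F.p k ∧ w ≠ T.root ∧
      T.par w = F.p k ∧ T.Le w y ∧ g ≠ T.root ∧ T.Le y (T.par g) ∧ y ≠ T.par g ∧
      T.Le g (F.s k) ∧ (T.up g).Finite ∧ γ (T.par g) = T.par g ∧ γ w = F.s k ∧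
      γ (F.s k) = w := by
  obtain ⟨k, hk, hyk, hyp, hys⟩ : ∃ k ∈ A, y ∈ F.seg k ∧ y ≠ F.p k ∧ y ≠ F.s k := by
    by_contra! h
    exact hm (hc.fix y hy hyP fun k hk h' => h'.2.2 (h k hk h'.1 h'.2.1))
  obtain ⟨hsP, hseg, hp⟩ := (hc.seg k hk).resolve_left fun h => hyP (h hyk)
  obtain ⟨w, hwr, hwp, hwy⟩ := hyk.1.exists_child hyp.symm
  obtain ⟨hw1, hw2⟩ := apply_eq_s hc.col hk hseg hp hwr hwp hwy hyk.2 hm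
  -- `h` is the highest vertex of the segment with an infinite branch. It turns out to be the second
  -- fixed point of the reflection, and the next vertex `g` has a finite branch.
  obtain ⟨h, ⟨hhk, hh⟩, hmax⟩ := Set.exists_max_image {z ∈ F.seg k | (T.up z).Infinite} T.lev
    (seg_finite.subset (Set.sep_subset _ _)) ⟨y, hyk, hy⟩
  have hyh : T.Le y h := hyk.2.of_lev_le hhk.2 (hmax y ⟨hyk, hy⟩)
  have hhs : h ≠ F.s k := by
    rintro rfl
    have h1 : γ (F.s k) = F.s k := hc.fix _ hh hsP fun j _ h' =>
      h'.2.2 (by rw [eq_of_mem h'.1 (F.s_mem k)])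
    rw [hw2] at h1
    exact hys (hyh.antisymm (h1 ▸ hwy))
  obtain ⟨g, hgr, rfl, hgs⟩ := hhk.2.exists_child hhs
  have hgk : g ∈ F.seg k := ⟨hhk.1.trans (par_le g), hgs⟩
  have hgfin : (T.up g).Finite := by
    by_contra hg
    have h1 := hmax g ⟨hgk, hg⟩
    have h2 := T.lev_par g hgr
    lia
  have hhp : T.par g ≠ F.p k := fun h => hyp ((h ▸ hyh).antisymm hyk.1)
  obtain ⟨n, -, h1, h2, h3⟩ := hc.exists_fixed hh hgfin
  have hfix : γ (T.par g) = T.par g := apply_eq_of_last hc.col hseg hgk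
    (fun h => hhp (((par_le g).trans (by rw [h]; exact le_refl _)).antisymm hhk.1)) rfl hhp
    h3 h1 h2
  exact ⟨k, hk, w, g, hyk, hseg, hp, hwr, hwp, hwy, hgr, hyh, fun h => hm (by rw [h, hfix]), hgs,
    hgfin, hfix, hw1, hw2⟩

/-- The two sides of a reflected segment are finite and interchanged. -/
theorem interchange (hγ : ∀ x y, (F.col A).Adj (γ x) (γ y) ↔ (F.col A).Adj x y)
    (hp : γ (F.p k) = F.p k) {g : V} (hwr : w ≠ T.root)
    (hwp : T.par w = F.p k) (hgr : g ≠ T.root) (hwg : T.Le w (T.par g)) (hgs : T.Le g (F.s k))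
    (hfix : γ (T.par g) = T.par g) (hws : γ w = F.s k) (hsw : γ (F.s k) = w) :
    (∀ z, T.Le w z → ¬ T.Le (T.par g) z → T.Le g (γ z)) ∧
      ∀ z, T.Le g z → T.Le w (γ z) ∧ ¬ T.Le (T.par g) (γ z) := by
  have hpw : T.Le (F.p k) w := hwp ▸ par_le w
  have hgk : g ∈ F.seg k := ⟨hpw.trans (hwg.trans (par_le g)), hgs⟩
  have hhk : T.par g ∈ F.seg k := ⟨hpw.trans hwg, (par_le g).trans hgs⟩
  have hwk : w ∈ F.seg k := ⟨hpw, hwg.trans hhk.2⟩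
  have hwg' : w ≠ T.par g := by
    intro h
    rw [← h, hws] at hfix
    rw [h] at hfix
    exact not_le_par hgr (hfix ▸ hgs)
  have hleaveR : ∀ a b, (F.span A).Adj a b → T.Le g a → ¬ T.Le g b → b = T.par g ∨ b = F.p k := by
    intro a b hab ha hb
    rcases hab with hab | hab
    · exact Or.inl (graph_adj_enter hab.symm hb ha).2.1.symm
    · obtain ⟨i, -, rfl, rfl, h1, -⟩ := edges_adj_enter hab.symm hb ha
      obtain rfl := eq_of_mem h1 hgk
      exact Or.inr rfl
  have hleaveL : ∀ a b, (F.span A).Adj a b → T.Le w a → ¬ T.Le (T.par g) a →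
      (T.Le w b ∧ ¬ T.Le (T.par g) b) ∨ b = T.par g ∨ b = F.p k := by
    intro a b hab ha ha'
    by_cases hb : T.Le (T.par g) b
    · rcases hab with hab | hab
      · exact Or.inr (Or.inl (graph_adj_enter hab ha' hb).1)
      · obtain ⟨i, -, rfl, rfl, h1, -⟩ := edges_adj_enter hab ha' hb
        obtain rfl := eq_of_mem h1 hhk
        rw [← hwp] at ha
        exact absurd ha (not_le_par hwr)
    by_cases hb' : T.Le w b
    · exact Or.inl ⟨hb', hb⟩
    · rcases hab with hab | hab
      · exact Or.inr (Or.inr ((graph_adj_enter hab.symm hb' ha).2.1.symm.trans hwp))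
      · obtain ⟨i, -, rfl, rfl, h1, -⟩ := edges_adj_enter hab.symm hb' ha
        obtain rfl := eq_of_mem h1 hwk
        exact Or.inr (Or.inr rfl)
  have hadj : ∀ z, z ≠ T.root → (F.span A).Adj (γ (T.par z)) (γ z) := fun z hz =>
    (span_adj_map_iff γ hγ _ _).2 (Or.inl (graph_adj_par hz))
  have hpg : ¬ T.Le g (F.p k) := fun h => by
    have h1 := h.lev_le
    have h2 := hgk.1.lev_le
    have h3 := T.lev_par g hgr
    have h4 := hhk.1.lev_le
    lia
  constructor
  · intro z hwz
    refine hwz.induction_up (Q := fun z => ¬ T.Le (T.par g) z → T.Le g (γ z))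
      (fun _ => hws ▸ hgs) ?_
    intro z hz hwz ih hgz
    have h1 := ih fun h => hgz (h.trans (par_le z))
    by_contra h2
    rcases hleaveR _ _ (hadj z hz) h1 h2 with h3 | h3
    · rw [← hfix] at h3
      exact hgz (γ.injective h3 ▸ le_refl _)
    · rw [← hp] at h3
      rw [γ.injective h3, ← hwp] at hwz
      exact not_le_par hwr (hwz.trans (par_le _))
  · have hstep : ∀ z b, T.Le g b → (F.span A).Adj (γ z) (γ b) →
        T.Le w (γ z) ∧ ¬ T.Le (T.par g) (γ z) → T.Le w (γ b) ∧ ¬ T.Le (T.par g) (γ b) := by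
      intro z b hb hzb h
      rcases hleaveL _ _ hzb h.1 h.2 with h1 | h1 | h1
      · exact h1
      · rw [← hfix] at h1
        rw [γ.injective h1] at hb
        exact absurd hb (not_le_par hgr)
      · rw [← hp] at h1
        rw [γ.injective h1] at hb
        exact absurd hb hpg
    have hg : T.Le w (γ g) ∧ ¬ T.Le (T.par g) (γ g) := by
      refine hgs.induction_down (Q := fun z => T.Le w (γ z) ∧ ¬ T.Le (T.par g) (γ z)) ?_ ?_
      · rw [hsw]
        exact ⟨le_refl w, fun h => hwg' (hwg.antisymm h)⟩
      · intro z hz hgz h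
        exact hstep z _ hgz (hadj z hz).symm h
    intro z hgz
    refine hgz.induction_up (Q := fun z => T.Le w (γ z) ∧ ¬ T.Le (T.par g) (γ z)) hg ?_
    intro z hz hgz h
    exact hstep _ z (hgz.trans (par_le z)) (hadj z hz) h

/-- The vertices close to `P` under `γ`. -/
def hull (γ : G ≃g G) (P : Set V) : Set V := {z | z ∈ P ∨ γ z ∈ P ∨ γ.symm z ∈ P}

theorem hull_finite (hP : P.Finite) : (hull γ P).Finite := by
  refine ((hP.union (hP.preimage γ.injective.injOn)).union
    (hP.preimage γ.symm.injective.injOn)).subset ?_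
  rintro z (h | h | h)
  exacts [Or.inl (Or.inl h), Or.inl (Or.inr h), Or.inr h]

theorem Controlled.hull_deg (hc : F.Controlled A γ P) (hv : v ∈ hull γ P) :
    (G.neighborSet v).Finite := by
  rcases hv with h | h | h
  · exact hc.deg v h
  · exact finite_neighborSet_of_apply γ (hc.deg _ h)
  · exact finite_neighborSet_of_apply γ.symm (hc.deg _ h)

/-- Adjacent moved vertices outside the hull of `P`. -/
def FarAdj (γ : G ≃g G) (P : Set V) (x y : V) : Prop :=
  MovedAdj γ x y ∧ x ∉ hull γ P ∧ y ∉ hull γ P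

theorem farAdj_class (hz : γ z ≠ z) (hzP : z ∉ hull γ P)
    (h : Relation.ReflTransGen (FarAdj γ P) z y) : γ y ≠ y ∧ y ∉ hull γ P := by
  rcases Relation.ReflTransGen.cases_tail h with rfl | ⟨w, _, h⟩
  exacts [⟨hz, hzP⟩, ⟨h.1.2.2, h.2.2⟩]

/-- By normality the class lies above its lowest vertex `y₀`. If the branch at `y₀` is infinite,
`y₀` is inside a reflected segment, and the class cannot leave the two interchanged sides. -/
theorem Controlled.far_class_subset (hc : F.Controlled A γ P) (hz : γ z ≠ z)
    (hzP : z ∉ hull γ P) : ∃ K : Set V, K.Finite ∧ (∀ v ∈ K, (G.neighborSet v).Finite) ∧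
      {y | Relation.ReflTransGen (FarAdj γ P) z y} ⊆ K := by
  obtain ⟨y₀, hy₀, hmin⟩ := exists_minimalFor_of_wellFoundedLT
    (Relation.ReflTransGen (FarAdj γ P) z) T.lev ⟨z, .refl⟩
  have hback : ∀ {y}, Relation.ReflTransGen (FarAdj γ P) z y →
      Relation.ReflTransGen (FarAdj γ P) y₀ y := by
    intro y hy
    have : Std.Symm (FarAdj γ P) := ⟨fun _ _ h => ⟨h.1.symm, h.2.2, h.2.1⟩⟩
    exact (symm hy₀).trans hy
  have hup : ∀ {y}, Relation.ReflTransGen (FarAdj γ P) y₀ y → T.Le y₀ y := by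
    intro y hy
    induction hy with
    | refl => exact le_refl _
    | @tail b c hb hbc ih =>
      by_contra hyc
      obtain ⟨h1, h2⟩ := Le.le_or_of_adj hbc.1.1 ih hyc
      have h3 := h1.lev_lt h2
      have h4 := hmin (hy₀.trans (hb.tail hbc)) h3.le
      lia
  obtain ⟨hm, hyP⟩ := farAdj_class hz hzP hy₀
  by_cases hfin : (T.up y₀).Finite
  · exact ⟨T.up y₀, hfin, fun v hv => finite_neighborSet hfin hv, fun y hy => hup (hback hy)⟩
  obtain ⟨k, hk, w, g, hyk, hseg, hp, hwr, hwp, hwy, hgr, hyh, hyne, hgs, hgfin, hfix, hws,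
    hsw⟩ := hc.exists_reflection hfin (fun h => hyP (Or.inl h)) hm
  obtain ⟨hLR, hRL⟩ := interchange hc.col hp hwr hwp hgr (hwy.trans hyh) hgs hfix hws hsw
  let QL : Set V := {z | T.Le w z ∧ ¬ T.Le (T.par g) z}
  have hLR' : ∀ z ∈ QL, γ z ∈ T.up g := fun z hz => hLR z hz.1 hz.2
  have hQLfin : QL.Finite := Set.Finite.of_finite_image
    (hgfin.subset (Set.image_subset_iff.2 hLR')) γ.injective.injOn
  refine ⟨QL ∪ T.up g, hQLfin.union hgfin, ?_, ?_⟩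
  · rintro v (hv | hv)
    · exact finite_neighborSet_of_apply γ (finite_neighborSet hgfin (hLR' v hv))
    · exact finite_neighborSet hgfin hv
  have hinv : ∀ z, γ z ∈ QL ∪ T.up g → z ∈ QL ∪ T.up g := by
    have himg : γ '' (QL ∪ T.up g) = QL ∪ T.up g := by
      refine Set.eq_of_subset_of_ncard_le ?_
        (Set.ncard_image_of_injective _ γ.injective).ge (hQLfin.union hgfin)
      rintro _ ⟨z, hz | hz, rfl⟩
      · exact Or.inr (hLR' z hz)
      · exact Or.inl (hRL z hz)
    intro z hz
    rw [← himg] at hz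
    obtain ⟨z', hz', h⟩ := hz
    exact γ.injective h ▸ hz'
  intro y hy
  replace hy := hback hy
  clear hmin
  induction hy with
  | refl => exact Or.inl ⟨hwy, fun h => hyne (hyh.antisymm h)⟩
  | @tail b y hb hby ih =>
    have hy₀y := hup (hb.tail hby)
    have hyh' : y ≠ T.par g := fun h => hby.1.2.2 (by rw [h, hfix])
    by_contra hyK
    rw [Set.mem_union, not_or] at hyK
    rcases ih with ihb | ihb
    -- Such an exit from the left side is excluded after applying `γ`: the image of `y` would lie
    -- strictly below `F.p k`, have an infinite branch and be inside no active segment. It would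
    -- then be fixed, although `y` is moved.
    · have h1 : γ y ∉ QL ∪ T.up g := fun h => (hinv y h).elim hyK.1 hyK.2
      rw [Set.mem_union, not_or] at h1
      obtain ⟨h2, h3⟩ := Le.le_or_of_adj (γ.map_adj_iff.2 hby.1.1) (hLR' b ihb) h1.2
      have h4 := h2.le_par h3
      have h5 : γ y ≠ T.par g := fun h => hyh' (γ.injective (h.trans hfix.symm))
      have h6 : ¬ T.Le w (γ y) := fun h => h1.1 ⟨h, fun h' => h5 (h4.antisymm h')⟩
      have h7 : T.Le (γ y) w := (h4.total (hwy.trans hyh)).resolve_right h6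
      have h8 : T.Le (γ y) (F.p k) := hwp ▸ h7.le_par fun h => h6 (h ▸ le_refl _)
      have h9 : γ y ≠ F.p k := fun h => by
        rw [← hp] at h
        rw [γ.injective h, ← hwp] at hy₀y
        exact not_le_par hwr (hwy.trans hy₀y)
      have hyU : (T.up (γ y)).Infinite := fun h =>
        hfin (h.subset (up_mono (h7.trans hwy)))
      have h10 : γ y ∉ P := fun h => hby.2.2 (Or.inr (Or.inl h))
      refine hby.1.2.2 (γ.injective (hc.fix _ hyU h10 ?_))
      rintro j hj ⟨h11, -, -⟩
      obtain ⟨-, h12, -⟩ := (hc.seg j hj).resolve_left fun h => h10 (h h11)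
      have h13 : F.p k ∈ F.seg j :=
        ⟨h11.1.trans h8, hyk.1.trans (hy₀y.trans ((h12 y).1 h11).2)⟩
      obtain rfl := eq_of_mem h13 (F.p_mem k)
      exact h9 (h8.antisymm h11.1)
    · obtain ⟨h1, h2⟩ := Le.le_or_of_adj hby.1.1 ihb hyK.2
      exact hyK.1 ⟨hwy.trans hy₀y, fun h => hyh' ((h1.le_par h2).antisymm h)⟩

/-- A class of moved vertices is covered by the hull of `P` and the far classes that start at `x` or
next to the hull. There are finitely many of these because the hull is finite with finite degrees.
-/
theorem Controlled.eq_refl (hG : HasInfiniteEdgeMotion G) (hc : F.Controlled A γ P) :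
    γ = SimpleGraph.Iso.refl := by
  by_contra hne
  obtain ⟨x, hx⟩ : ∃ x, γ x ≠ x := by
    by_contra! h
    exact hne (RelIso.ext h)
  let base : Set V := {b | b ∉ hull γ P ∧ γ b ≠ b ∧ (b = x ∨ ∃ a ∈ hull γ P, G.Adj a b)}
  have hbase : base.Finite := by
    refine ((Set.finite_singleton x).union
      ((hull_finite (γ := γ) hc.fin).biUnion fun a ha => hc.hull_deg ha)).subset ?_
    rintro b ⟨-, -, rfl | ⟨a, ha, hab⟩⟩
    · exact Or.inl rfl
    · exact Or.inr (Set.mem_biUnion ha hab)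
  have hex : ∀ b ∈ base, ∃ K : Set V, K.Finite ∧ (∀ v ∈ K, (G.neighborSet v).Finite) ∧
      {y | Relation.ReflTransGen (FarAdj γ P) b y} ⊆ K := fun b hb =>
    hc.far_class_subset hb.2.1 hb.1
  choose! K hK1 hK2 hK3 using hex
  have hsub : ∀ y, Relation.ReflTransGen (MovedAdj γ) x y → y ∈ hull γ P ∨
      ∃ b ∈ base, Relation.ReflTransGen (FarAdj γ P) b y := by
    intro y hy
    induction hy with
    | refl =>
      by_cases h : x ∈ hull γ P
      · exact Or.inl h
      · exact Or.inr ⟨x, ⟨h, hx, Or.inl rfl⟩, .refl⟩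
    | @tail b y _ hby ih =>
      by_cases h : y ∈ hull γ P
      · exact Or.inl h
      rcases ih with ih | ⟨a, ha, hab⟩
      · exact Or.inr ⟨y, ⟨h, hby.2.2, Or.inr ⟨b, ih, hby.1⟩⟩, .refl⟩
      · exact Or.inr ⟨a, ha, hab.tail ⟨hby, (farAdj_class ha.2.1 ha.1 hab).2, h⟩⟩
  refine hG.movedAdj_class_not_finite γ hx ?_ ?_
  · refine ((hull_finite (γ := γ) hc.fin).union (hbase.biUnion hK1)).subset fun y hy => ?_
    rcases hsub y hy with h | ⟨b, hb, h⟩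
    · exact Or.inl h
    · exact Or.inr (Set.mem_biUnion hb (hK3 b hb h))
  · intro y hy
    rcases hsub y hy with h | ⟨b, hb, h⟩
    · exact hc.hull_deg h
    · exact hK2 b hb y (hK3 b hb h)

end Flags
end NormalTree
end EdgeColouring

/-! ### The connected case -/

namespace EdgeColouring
variable {V : Type*} {G : SimpleGraph V}

namespace NormalTree
namespace Flags

variable {T : NormalTree G} {F : T.Flags} {A : Set ℕ} {γ : G ≃g G}

theorem freq_exists_notMem (hA : ∀ v, (T.up v).Infinite → {n ∈ A | T.Le v (F.p n)}.Infinite)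
    {v : V} (hv : (T.up v).Infinite) {N : Set ℕ} (hN : N.Finite) :
    ∃ n ∈ A, T.Le v (F.p n) ∧ n ∉ N := by
  obtain ⟨n, ⟨h1, h2⟩, h3⟩ := ((hA v hv).sdiff hN).nonempty
  exact ⟨n, h1, h2, h3⟩

/-- The image of the root has infinite degree, hence an infinite branch, and it lies in no active
segment. A flag high in that branch has a fixed lower end, and distances to it show that the root
cannot move. -/
theorem apply_root_eq (hγ : ∀ x y, (F.col A).Adj (γ x) (γ y) ↔ (F.col A).Adj x y)
    (hA : ∀ v, (T.up v).Infinite → {n ∈ A | T.Le v (F.p n)}.Infinite)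
    (hr : (G.neighborSet T.root).Infinite) : γ T.root = T.root := by
  have hup : (T.up (γ T.root)).Infinite := fun h =>
    hr (finite_neighborSet_of_apply γ (finite_neighborSet h (le_refl _)))
  have hseg : ∀ k ∈ A, γ T.root ∉ F.seg k := by
    intro k hk h
    obtain ⟨m, -, hm⟩ := exists_map_seg_iff γ.symm (symm_transport γ hγ) hk
    rw [← hm, RelIso.symm_apply_apply] at h
    exact root_notMem h
  obtain ⟨n, hn, h1, h2⟩ := freq_exists_notMem hA hup
    (Set.finite_Iio ((F.span A).dist T.root (γ T.root)))
  obtain ⟨-, h3⟩ := mem_of_dist_le γ hγ hn (not_lt.1 h2)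
  have h4 : γ (F.p n) = F.p n := apply_p_eq hγ h3 fun h =>
    hseg n hn (h1.antisymm h ▸ F.p_mem n)
  by_contra hne
  have h5 := dist_eq_of_enter (F.span_connected A) (le_refl (γ T.root))
    (enter_up fun k hk h => hseg k hk h.1)
    (fun h : T.Le _ T.root => hne (h.antisymm (root_le _))) h1
  have h6 := dist_map γ hγ T.root (F.p n)
  rw [h4] at h6
  exact hne ((F.span_connected A).dist_eq_zero_iff.1
    (show (F.span A).dist T.root (γ T.root) = 0 by lia)).symm

/-- If the root has infinite degree it is fixed and `P = ∅` works. Otherwise `G` is locally finite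
and any finite `P` is allowed: it takes the finitely many segments not known to be preserved, and
the vertices below one fixed `F.p n₀`, which then serves as the fixed vertex not above `v`. -/
theorem exists_controlled (hγ : ∀ x y, (F.col A).Adj (γ x) (γ y) ↔ (F.col A).Adj x y)
    (hA : ∀ v, (T.up v).Infinite → {n ∈ A | T.Le v (F.p n)}.Infinite)
    (hroot : (T.up T.root).Infinite)
    (hr : (G.neighborSet T.root).Infinite ∨ ∀ v, (G.neighborSet v).Finite) :
    ∃ P, F.Controlled A γ P := by
  rcases hr with hr | hdeg
  · have h0 := apply_root_eq hγ hA hr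
    have hseg : ∀ n ∈ A, (∀ z, γ z ∈ F.seg n ↔ z ∈ F.seg n) ∧ γ (F.p n) = F.p n := by
      intro n hn
      have h1 := (mem_of_dist_le γ hγ hn (by rw [h0, SimpleGraph.dist_self]; exact n.zero_le)).2
      exact ⟨h1, apply_p_eq hγ h1 fun h => F.p_ne_root n ((h0 ▸ h).antisymm (root_le _))⟩
    refine ⟨∅, Set.finite_empty, fun v hv => hv.elim, hγ,
      fun n hn => Or.inr ⟨Set.notMem_empty _, hseg n hn⟩, ?_, hA⟩
    intro v hv _ hk
    by_cases hvr : v = T.root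
    · rw [hvr, h0]
    · obtain ⟨n, hn, h1, -⟩ := freq_exists_notMem hA hv Set.finite_empty
      exact apply_eq_of_fixed hγ hk h0 (fun h => hvr (h.antisymm (root_le _))) (hseg n hn).2 h1
  · let N : Set ℕ := Set.Iio ((F.span A).dist T.root (γ T.root)) ∪
      {n | T.Le (F.p n) (γ T.root)}
    have hN : N.Finite := (Set.finite_Iio _).union
      (Set.Finite.preimage (f := F.p) F.p_injective.injOn (finite_le (T := T) (γ T.root)))
    have hseg : ∀ n ∈ A, n ∉ N → (∀ z, γ z ∈ F.seg n ↔ z ∈ F.seg n) ∧ γ (F.p n) = F.p n := by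
      intro n hn hnN
      rw [Set.mem_union, not_or] at hnN
      have h1 := (mem_of_dist_le γ hγ hn (not_lt.1 hnN.1)).2
      exact ⟨h1, apply_p_eq hγ h1 hnN.2⟩
    obtain ⟨n₀, hn₀, -, h2⟩ := freq_exists_notMem hA hroot hN
    refine ⟨{z | T.Le z (F.p n₀)} ∪ ⋃ n ∈ N, F.seg n,
      (finite_le _).union (hN.biUnion fun n _ => seg_finite), fun v _ => hdeg v, hγ, ?_, ?_, hA⟩
    · intro n hn
      by_cases hnN : n ∈ N
      · exact Or.inl fun z hz => Or.inr (Set.mem_biUnion hnN hz)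
      by_cases hs : T.Le (F.s n) (F.p n₀)
      · exact Or.inl fun z hz => Or.inl (hz.2.trans hs)
      · refine Or.inr ⟨?_, hseg n hn hnN⟩
        rintro (h | h)
        · exact hs h
        · obtain ⟨m, hm, h3⟩ := Set.mem_iUnion₂.1 h
          exact hnN (eq_of_mem h3 (F.s_mem n) ▸ hm)
    · intro v hv hvP hk
      obtain ⟨n, hn, h3, h4⟩ := freq_exists_notMem hA hv hN
      exact apply_eq_of_fixed hγ hk (hseg n₀ hn₀ h2).2 (fun h => hvP (Or.inl h))
        (hseg n hn h4).2 h3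

end Flags
end NormalTree

/-- The index set of the flags that are active for the parameter `X`. -/
def active (X : Set ℕ) : Set ℕ := {n | Even n ∨ (n.div2).unpair.1 ∈ X}

open NormalTree in
theorem exists_family_of_connected [Countable V] [Infinite V] (hconn : G.Connected)
    (hG : HasInfiniteEdgeMotion G) : ∃ col : Set ℕ → SimpleGraph V, (∀ X, col X ≤ G) ∧
      ∀ X X' (γ : G ≃g G), (∀ x y, (col X').Adj (γ x) (γ y) ↔ (col X).Adj x y) →
        X = X' ∧ γ = SimpleGraph.Iso.refl := by
  obtain ⟨T, hr⟩ : ∃ T : NormalTree G,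
      (G.neighborSet T.root).Infinite ∨ ∀ v, (G.neighborSet v).Finite := by
    by_cases h : ∃ r, (G.neighborSet r).Infinite
    · obtain ⟨r, hr⟩ := h
      obtain ⟨T, rfl⟩ := exists_normalTree hconn r
      exact ⟨T, Or.inl hr⟩
    · obtain ⟨r⟩ := hconn.nonempty
      obtain ⟨T, -⟩ := exists_normalTree hconn r
      exact ⟨T, Or.inr fun v => Set.not_infinite.1 fun h' => h ⟨v, h'⟩⟩
  have hroot : (T.up T.root).Infinite := by
    have : T.up T.root = Set.univ := Set.eq_univ_of_forall root_le
    rw [this]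
    exact Set.infinite_univ
  have : Nonempty {v // (T.up v).Infinite} := ⟨⟨_, hroot⟩⟩
  obtain ⟨g, hg⟩ := exists_surjective_nat {v // (T.up v).Infinite}
  obtain ⟨F, hF⟩ := exists_flags hG T (fun n => (g n.div2.unpair.1).1) fun n => (g _).2
  -- The even indices are active for every `X` and already visit each infinite branch infinitely
  -- often.
  have hA : ∀ X v, (T.up v).Infinite → {n ∈ active X | T.Le v (F.p n)}.Infinite := by
    intro X v hv
    obtain ⟨i, hi⟩ := hg ⟨v, hv⟩
    refine Set.infinite_of_injective_forall_mem (f := fun j => 2 * Nat.pair i j) ?_ ?_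
    · intro j j' h
      exact (Nat.pair_eq_pair.1 (Nat.eq_of_mul_eq_mul_left two_pos h)).2
    · intro j
      refine ⟨Or.inl (even_two_mul _), ?_⟩
      have := hF (2 * Nat.pair i j)
      simp only [Nat.div2_val, Nat.mul_div_cancel_left _ two_pos, Nat.unpair_pair, hi] at this
      exact this
  refine ⟨fun X => F.col (active X), fun X => F.col_le _, fun X X' γ hγ => ?_⟩
  have hX : X = X' := by
    ext i
    -- An odd index that codes the bit `i` and is at least the displacement of the root.
    have h := Flags.mem_iff_of_dist_le γ hγ (n := 2 * Nat.pair i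
      ((F.span (active X')).dist T.root (γ T.root)) + 1)
      (by have := Nat.right_le_pair i ((F.span (active X')).dist T.root (γ T.root)); lia)
    have hodd : ∀ Y : Set ℕ, ∀ m, 2 * m + 1 ∈ active Y ↔ m.unpair.1 ∈ Y := by
      intro Y m
      have : ¬ Even (2 * m + 1) := by simp
      simp only [active, Set.mem_ofPred_eq, this, false_or, Nat.div2_val]
      rw [show (2 * m + 1) / 2 = m by lia]
    rw [hodd, hodd, Nat.unpair_pair] at h
    exact h
  subst hX
  obtain ⟨P, hP⟩ := Flags.exists_controlled hγ (hA X) hroot hr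
  exact ⟨rfl, hP.eq_refl hG⟩

end EdgeColouring

/-! ### Disconnected graphs and the number of colourings -/

namespace EdgeColouring
variable {V : Type*} {G : SimpleGraph V}

theorem HasInfiniteEdgeMotion.toSimpleGraph (hG : HasInfiniteEdgeMotion G)
    (C : G.ConnectedComponent) : HasInfiniteEdgeMotion C.toSimpleGraph := by
  classical
  intro γ hγ
  let f : Equiv.Perm V := Equiv.Perm.ofSubtype (p := (· ∈ C)) γ.toEquiv
  have hf : ∀ x (hx : x ∈ C), f x = γ ⟨x, hx⟩ := fun x hx =>
    Equiv.Perm.ofSubtype_apply_of_mem (p := (· ∈ C)) γ.toEquiv hx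
  have hf' : ∀ x, x ∉ C → f x = x := fun x hx =>
    Equiv.Perm.ofSubtype_apply_of_not_mem (p := (· ∈ C)) γ.toEquiv hx
  have hrel : ∀ x y, G.Adj (f x) (f y) ↔ G.Adj x y := by
    intro x y
    by_cases hx : x ∈ C <;> by_cases hy : y ∈ C
    · rw [hf x hx, hf y hy]
      exact γ.map_adj_iff (v := ⟨x, hx⟩) (w := ⟨y, hy⟩)
    · rw [hf x hx, hf' y hy]
      exact iff_of_false (fun h => hy (C.mem_supp_of_adj_mem_supp (γ ⟨x, hx⟩).2 h))
        fun h => hy (C.mem_supp_of_adj_mem_supp hx h)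
    · rw [hf' x hx, hf y hy]
      exact iff_of_false (fun h => hx (C.mem_supp_of_adj_mem_supp (γ ⟨y, hy⟩).2 h.symm))
        fun h => hx (C.mem_supp_of_adj_mem_supp hy h.symm)
    · rw [hf' x hx, hf' y hy]
  let δ : G ≃g G := ⟨f, fun {x y} => hrel x y⟩
  have hδ : δ ≠ SimpleGraph.Iso.refl := by
    intro h
    refine hγ (RelIso.ext fun x => Subtype.ext ?_)
    rw [← hf x.1 x.2]
    exact congrArg (fun δ : G ≃g G => δ x.1) h
  intro hfin
  refine hG δ hδ ((hfin.image C.toSimpleGraph_hom.mapEdgeSet).subset ?_)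
  rintro ⟨e, he⟩ hmoved
  induction e with | _ x y =>
  rw [SimpleGraph.mem_edgeSet] at he
  by_cases hx : x ∈ C
  · have hy : y ∈ C := C.mem_supp_of_adj_mem_supp hx he
    refine ⟨⟨s(⟨x, hx⟩, ⟨y, hy⟩), he⟩, fun h => hmoved (Subtype.ext ?_), Subtype.ext rfl⟩
    have h1 : s(γ ⟨x, hx⟩, γ ⟨y, hy⟩) = s(⟨x, hx⟩, ⟨y, hy⟩) := congrArg Subtype.val h
    have h2 := congrArg (Sym2.map Subtype.val) h1
    simp only [Sym2.map_mk, ← hf] at h2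
    exact h2
  · have hy : y ∉ C := fun hy => hx (C.mem_supp_of_adj_mem_supp hy he.symm)
    refine absurd (Subtype.ext ?_) hmoved
    change s(f x, f y) = s(x, y)
    rw [hf' x hx, hf' y hy]

/-- The restriction of an automorphism to a component. -/
def componentIso (γ : G ≃g G) (C : G.ConnectedComponent) :
    C.toSimpleGraph ≃g (γ.connectedComponentEquiv C).toSimpleGraph :=
  ⟨SimpleGraph.ConnectedComponent.isoEquivSupp γ C, γ.map_adj_iff⟩

theorem HasInfiniteEdgeMotion.apply_eq_of_finite_component (hG : HasInfiniteEdgeMotion G)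
    (γ : G ≃g G) {C : G.ConnectedComponent} (hC : C.supp.Finite) {x : V} (hx : x ∈ C.supp) :
    γ x = x := by
  let C' := γ.connectedComponentEquiv C
  have hmap : Set.MapsTo γ C.supp C'.supp := fun x hx => (componentIso γ C ⟨x, hx⟩).2
  have hmap' : Set.MapsTo γ.symm C'.supp C.supp := fun x hx =>
    ((componentIso γ C).symm ⟨x, hx⟩).2
  have hC' : C'.supp.Finite := (hC.image γ).subset fun y hy =>
    ⟨γ.symm y, hmap' hy, RelIso.apply_symm_apply _ _⟩
  have hdeg : ∀ D : G.ConnectedComponent, D.supp.Finite → ∀ v ∈ D.supp,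
      (G.neighborSet v).Finite := fun D hD v hv =>
    hD.subset fun w hw => D.mem_supp_of_adj_mem_supp hv hw
  refine hG.swap_eq_self (σ := γ) (τ := γ.symm) hmap hmap'
    (fun x _ => RelIso.symm_apply_apply _ _) (fun x _ => RelIso.apply_symm_apply _ _) ?_
    (fun _ _ _ _ => γ.map_adj_iff) ?_ ?_ hC (hdeg C hC) (hdeg C' hC') x hx
  · by_cases h : C = C'
    · exact Or.inl (congrArg _ h)
    · exact Or.inr (Set.disjoint_left.2 fun y hy hy' =>
        h (SimpleGraph.ConnectedComponent.eq_of_common_vertex hy hy'))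
  · intro x hx z hz hz'
    exact iff_of_false (fun h => hz' (C'.mem_supp_of_adj_mem_supp (hmap hx) h))
      fun h => hz (C.mem_supp_of_adj_mem_supp hx h)
  · intro hd x hx y hy h
    exact Set.disjoint_left.1 hd (C.mem_supp_of_adj_mem_supp hx h) hy

/-- Two components are equivalent if they are isomorphic. -/
def componentSetoid (G : SimpleGraph V) : Setoid G.ConnectedComponent where
  r C C' := Nonempty (C.toSimpleGraph ≃g C'.toSimpleGraph)
  iseqv := ⟨fun _ => ⟨SimpleGraph.Iso.refl⟩, fun ⟨φ⟩ => ⟨φ.symm⟩, fun ⟨φ⟩ ⟨ψ⟩ => ⟨φ.trans ψ⟩⟩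

/-- A set of natural numbers that encodes the pair `(i, Z)`. -/
def encode (i : ℕ) (Z : Set ℕ) : Set ℕ := {n | (Even n ∧ n / 2 = i) ∨ (¬ Even n ∧ n / 2 ∈ Z)}

theorem encode_inj {i i' : ℕ} {Z Z' : Set ℕ} (h : encode i Z = encode i' Z') :
    i = i' ∧ Z = Z' := by
  have h1 : ∀ j Y m, 2 * m ∈ encode j Y ↔ m = j := by
    intro j Y m
    simp [encode]
  have h2 : ∀ j Y m, 2 * m + 1 ∈ encode j Y ↔ m ∈ Y := by
    intro j Y m
    have h3 : (2 * m + 1) / 2 = m := by lia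
    simp [encode, h3]
  constructor
  · rw [← h1 i' Z' i, ← h, h1]
  · ext m
    rw [← h2 i Z, h, h2]

/-- All components of one isomorphism type take their colourings from the same family, on a chosen
representative, with distinct component indices coded into the parameter. A colour-preserving
isomorphism thus forces equal indices, and then it is the identity. -/
theorem exists_component_family [Countable V] (hG : HasInfiniteEdgeMotion G) :
    ∃ col : ∀ C : G.ConnectedComponent, Set ℕ → SimpleGraph C,
      (∀ C Z, col C Z ≤ C.toSimpleGraph) ∧
      ∀ (C C' : G.ConnectedComponent) (Z Z' : Set ℕ), Infinite C →
        ∀ ψ : C.toSimpleGraph ≃g C'.toSimpleGraph,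
        (∀ x y, (col C' Z').Adj (ψ x) (ψ y) ↔ (col C Z).Adj x y) →
          Z = Z' ∧ ∀ x, (ψ x : V) = x := by
  have hbase : ∀ C : G.ConnectedComponent, ∃ col : Set ℕ → SimpleGraph C,
      (∀ X, col X ≤ C.toSimpleGraph) ∧ (Infinite C → ∀ X X'
        (γ : C.toSimpleGraph ≃g C.toSimpleGraph),
        (∀ x y, (col X').Adj (γ x) (γ y) ↔ (col X).Adj x y) →
          X = X' ∧ γ = SimpleGraph.Iso.refl) := by
    intro C
    by_cases h : Infinite C
    · obtain ⟨col, h1, h2⟩ := exists_family_of_connected C.connected_toSimpleGraph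
        (hG.toSimpleGraph C)
      exact ⟨col, h1, fun _ => h2⟩
    · exact ⟨fun _ => ⊥, fun _ => bot_le, fun h' => absurd h' h⟩
  choose base hle hbase using hbase
  let R : G.ConnectedComponent → G.ConnectedComponent := fun C =>
    (Quotient.mk (componentSetoid G) C).out
  have hR : ∀ C, Nonempty (C.toSimpleGraph ≃g (R C).toSimpleGraph) := fun C =>
    (componentSetoid G).symm (Quotient.mk_out (s := componentSetoid G) C)
  let φ := fun C => (hR C).some
  have : Countable G.ConnectedComponent := Quot.mk_surjective.countable
  obtain ⟨idx, hidx⟩ := exists_injective_nat G.ConnectedComponent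
  refine ⟨fun C Z => (base (R C) (encode (idx C) Z)).comap (φ C), fun C Z x y h =>
    (φ C).map_adj_iff.1 (hle _ _ h), ?_⟩
  intro C C' Z Z' hinf ψ hψ
  -- Stated for arbitrary `D = D'` so that the equality of the two representatives can be
  -- eliminated.
  have key : ∀ (D D' : G.ConnectedComponent) (φ : C.toSimpleGraph ≃g D.toSimpleGraph)
      (φ' : C'.toSimpleGraph ≃g D'.toSimpleGraph), D = D' →
      (∀ x y, (base D' (encode (idx C') Z')).Adj (φ' (ψ x)) (φ' (ψ y)) ↔
        (base D (encode (idx C) Z)).Adj (φ x) (φ y)) →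
      encode (idx C) Z = encode (idx C') Z' := by
    rintro D _ φ φ' rfl h
    have : Infinite D := Infinite.of_injective φ φ.injective
    refine (hbase D this _ _ (φ.symm.trans (ψ.trans φ')) fun x y => ?_).1
    have h1 := h (φ.symm x) (φ.symm y)
    rw [RelIso.apply_symm_apply, RelIso.apply_symm_apply] at h1
    exact h1
  have hRR : R C = R C' := congrArg Quotient.out
    (Quotient.sound (s := componentSetoid G) ⟨ψ⟩)
  obtain ⟨h1, rfl⟩ := encode_inj (key _ _ (φ C) (φ C') hRR hψ)
  obtain rfl := hidx h1
  have : Infinite (R C) := Infinite.of_injective (φ C) (φ C).injective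
  refine ⟨rfl, fun x => ?_⟩
  have h2 := (hbase (R C) this _ _ ((φ C).symm.trans (ψ.trans (φ C))) fun x y => by
    have h1 := hψ ((φ C).symm x) ((φ C).symm y)
    simp only [SimpleGraph.comap_adj, RelIso.apply_symm_apply] at h1
    exact h1).2
  have h3 : φ C (ψ ((φ C).symm (φ C x))) = φ C x :=
    congrArg (fun δ : (R C).toSimpleGraph ≃g (R C).toSimpleGraph => δ (φ C x)) h2
  rw [RelIso.symm_apply_apply] at h3
  rw [(φ C).injective h3]

open Classical in
/-- The edge colouring in which the edges of `C` receive the colour `1`. -/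
noncomputable def colouring (C : SimpleGraph V) (e : G.edgeSet) : Fin 2 :=
  if e.1 ∈ C.edgeSet then 1 else 0

theorem adj_iff_of_colouring {C C' : SimpleGraph V} (hC : C ≤ G) (hC' : C' ≤ G) {γ : G ≃g G}
    (h : colouring C' ∘ γ.mapEdgeSet = colouring (G := G) C) (x y : V) :
    C'.Adj (γ x) (γ y) ↔ C.Adj x y := by
  by_cases hxy : G.Adj x y
  · have h1 := congrFun h ⟨s(x, y), hxy⟩
    have h2 : (γ.mapEdgeSet ⟨s(x, y), hxy⟩).1 = s(γ x, γ y) := rfl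
    simp only [Function.comp_apply, colouring, h2, SimpleGraph.mem_edgeSet] at h1
    by_cases h3 : C'.Adj (γ x) (γ y) <;> by_cases h4 : C.Adj x y <;> simp_all
  · exact iff_of_false (fun h => hxy (γ.map_adj_iff.1 (hC' h))) fun h => hxy (hC h)

theorem HasInfiniteEdgeMotion.eq_refl_of_finite_components (hG : HasInfiniteEdgeMotion G)
    (h : ∀ C : G.ConnectedComponent, C.supp.Finite) (γ : G ≃g G) :
    γ = SimpleGraph.Iso.refl :=
  RelIso.ext fun x => hG.apply_eq_of_finite_component γ (h (G.connectedComponentMk x)) rfl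

/-- With finitely many edges there would be two isolated vertices, and these could be swapped. -/
theorem infinite_edgeSet [Infinite V] (h : ∀ γ : G ≃g G, γ = SimpleGraph.Iso.refl) :
    Infinite G.edgeSet := by
  classical
  by_contra hfin
  rw [not_infinite_iff_finite] at hfin
  let S : Set V := {v | ∃ w, G.Adj v w}
  have hS : S.Finite := by
    have h1 : (⋃ e ∈ G.edgeSet, {v | v ∈ e}).Finite := by
      refine (Set.toFinite G.edgeSet).biUnion fun e _ => ?_
      induction e with | _ x y =>
      refine (Set.toFinite {x, y}).subset fun v hv => ?_
      rcases Sym2.mem_iff.1 hv with rfl | rfl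
      exacts [Or.inl rfl, Or.inr rfl]
    refine h1.subset ?_
    rintro v ⟨w, hw⟩
    exact Set.mem_biUnion (x := s(v, w)) hw (Sym2.mem_mk_left v w)
  obtain ⟨x, hx⟩ := hS.infinite_compl.nonempty
  obtain ⟨y, hy, hyx⟩ := (hS.infinite_compl.sdiff (Set.finite_singleton x)).nonempty
  have hadj : ∀ a b, G.Adj a b → Equiv.swap x y a = a := by
    intro a b hab
    refine Equiv.swap_apply_of_ne_of_ne ?_ ?_
    · rintro rfl; exact hx ⟨b, hab⟩
    · rintro rfl; exact hy ⟨b, hab⟩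
  have hmap : ∀ a b, G.Adj a b → G.Adj (Equiv.swap x y a) (Equiv.swap x y b) := by
    intro a b hab
    rwa [hadj a b hab, hadj b a hab.symm]
  have h1 := h ⟨Equiv.swap x y, fun {a b} => ⟨fun hab => by
    have := hmap _ _ hab
    rwa [Equiv.swap_apply_self, Equiv.swap_apply_self] at this, hmap a b⟩⟩
  have h2 : Equiv.swap x y x = x := congrArg (fun δ : G ≃g G => δ x) h1
  rw [Equiv.swap_apply_left] at h2
  exact hyx h2

theorem exists_family [Countable V] [Infinite V] (hG : HasInfiniteEdgeMotion G) :
    ∃ Φ : Set ℕ → G.edgeSet → Fin 2, ∀ Z Z' (γ : G ≃g G), Φ Z' ∘ γ.mapEdgeSet = Φ Z →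
      Z = Z' ∧ γ = SimpleGraph.Iso.refl := by
  classical
  by_cases hinf : ∃ C : G.ConnectedComponent, C.supp.Infinite
  · obtain ⟨col, hle, hcol⟩ := exists_component_family hG
    let Φ : Set ℕ → SimpleGraph V := fun Z =>
      { Adj := fun x y => ∃ (C : G.ConnectedComponent) (hx : x ∈ C) (hy : y ∈ C),
          (col C Z).Adj ⟨x, hx⟩ ⟨y, hy⟩
        symm := ⟨fun _ _ ⟨C, hx, hy, h⟩ => ⟨C, hy, hx, h.symm⟩⟩
        loopless := ⟨fun _ ⟨_, _, _, h⟩ => h.ne rfl⟩ }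
    have hΦ : ∀ Z, Φ Z ≤ G := by
      rintro Z x y ⟨C, hx, hy, h⟩
      exact hle C Z h
    have hΦadj : ∀ Z (C : G.ConnectedComponent) (x y : C),
        (Φ Z).Adj x y ↔ (col C Z).Adj x y := by
      rintro Z C ⟨x, hx⟩ ⟨y, hy⟩
      refine ⟨?_, fun h => ⟨C, hx, hy, h⟩⟩
      rintro ⟨D, hx', hy', h⟩
      obtain rfl := SimpleGraph.ConnectedComponent.eq_of_common_vertex hx hx'
      exact h
    refine ⟨fun Z => colouring (Φ Z), fun Z Z' γ h => ?_⟩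
    have hadj := adj_iff_of_colouring (hΦ Z) (hΦ Z') h
    have hC : ∀ C : G.ConnectedComponent, C.supp.Infinite → Z = Z' ∧ ∀ x ∈ C.supp, γ x = x := by
      intro C hC
      obtain ⟨h1, h2⟩ := hcol C _ Z Z' hC.to_subtype (componentIso γ C) fun x y => by
        rw [← hΦadj, ← hΦadj]
        exact hadj x y
      exact ⟨h1, fun x hx => h2 ⟨x, hx⟩⟩
    obtain ⟨C, hCinf⟩ := hinf
    refine ⟨(hC C hCinf).1, RelIso.ext fun x => ?_⟩
    by_cases hx : (G.connectedComponentMk x).supp.Infinite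
    · exact (hC _ hx).2 x rfl
    · exact hG.apply_eq_of_finite_component γ (Set.not_infinite.1 hx) rfl
  · have htriv := hG.eq_refl_of_finite_components fun C =>
      Set.not_infinite.1 fun h => hinf ⟨C, h⟩
    have := infinite_edgeSet htriv
    let f := Infinite.natEmbedding G.edgeSet
    -- Without symmetries, different colourings are never isomorphic.
    refine ⟨fun Z e => if e ∈ f '' Z then 1 else 0, fun Z Z' γ h => ⟨?_, htriv γ⟩⟩
    have hrefl : γ.mapEdgeSet = Equiv.refl _ := by
      rw [htriv γ]
      refine Equiv.ext fun e => Subtype.ext ?_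
      change Sym2.map id e.1 = e.1
      rw [Sym2.map_id, id]
    rw [hrefl] at h
    ext n
    have h1 := congrFun h (f n)
    simp only [Function.comp_apply, Equiv.refl_apply, f.injective.mem_set_image] at h1
    by_cases h2 : n ∈ Z <;> by_cases h3 : n ∈ Z' <;> simp_all

theorem distinguishingIndex_le_two {c : G.edgeSet → Fin 2} (hc : IsDistinguishing c) :
    distinguishingIndex G ≤ 2 :=
  iInf₂_le 2 ⟨c, hc⟩

end EdgeColouring

theorem mainTheorem1 {V : Type*} [Countable V] (G : SimpleGraph V)
    (hG : EdgeColouring.HasInfiniteEdgeMotion G) :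
    (Infinite V → #(Quotient (EdgeColouring.isoSetoid G (Fin 2))) = 𝔠) ∧
      EdgeColouring.distinguishingIndex G ≤ 2 := by
  refine ⟨fun _ => le_antisymm ?_ ?_, ?_⟩
  · have h1 : Function.Injective
        (fun c : EdgeColouring.DistinguishingColouring G (Fin 2) => c.1) :=
      Subtype.val_injective
    refine (Cardinal.mk_quotient_le.trans (Cardinal.mk_le_of_injective h1)).trans ?_
    rw [Cardinal.mk_arrow, Cardinal.mk_fin, Cardinal.lift_natCast, Nat.cast_ofNat,
      Cardinal.lift_uzero]
    exact (Cardinal.power_le_power_left two_ne_zero Cardinal.mk_le_aleph0).trans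
      Cardinal.two_power_aleph0.le
  · obtain ⟨Φ, hΦ⟩ := EdgeColouring.exists_family hG
    let Ψ : Set ℕ → Quotient (EdgeColouring.isoSetoid G (Fin 2)) := fun Z =>
      Quotient.mk _ ⟨Φ Z, fun γ h => (hΦ Z Z γ h).2⟩
    have hΨ : Function.Injective Ψ := by
      intro Z Z' h
      obtain ⟨γ, hγ⟩ := Quotient.exact h
      exact (hΦ Z' Z γ hγ).1.symm
    have h1 := Cardinal.lift_mk_le_lift_mk_of_injective hΨ
    rw [Cardinal.mk_set, Cardinal.mk_nat, Cardinal.two_power_aleph0, Cardinal.lift_continuum,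
      Cardinal.lift_uzero] at h1
    exact h1
  · rcases finite_or_infinite V with h | h
    · refine EdgeColouring.distinguishingIndex_le_two (c := fun _ => 0) fun γ _ => ?_
      exact hG.eq_refl_of_finite_components (fun C => Set.toFinite _) γ
    · obtain ⟨Φ, hΦ⟩ := EdgeColouring.exists_family hG
      exact EdgeColouring.distinguishingIndex_le_two fun γ h => (hΦ ∅ ∅ γ h).2
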